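/- Let $l\ge 4$, $N=2l-2$, and let $U\subset\mathbb R^2$ be open. Let $z=(x+iy)/2$, $\bar z=(x-iy)/2$, so that $\partial_z=\partial_x-i\partial_y$, $\partial_{\bar z}=\partial_x+i\partial_y$ and $\triangle=\partial_z\partial_{\bar z}=\partial_x^2+\partial_y^2$. Let $\{k\}\in\{0,\dots,N-1\}$ be the remainder of an integer $k$ modulo $N$; subscripts of blocks (and of $\gamma$, $g$) may be any integers, subscripts of blocks being read modulo $N$. The elliptic $D_l^{(1)}$ Toda equation for real $C^2$ functions $u_1,\dots,u_l$ on $U$ is $$\begin{aligned} &\triangle u_1=e^{u_2+u_1}-e^{u_2-u_1},\qquad \triangle u_2=e^{u_2+u_1}+e^{u_2-u_1}-e^{u_3-u_2},\\ &\triangle u_j=e^{u_j-u_{j-1}}-e^{u_{j+1}-u_j}\quad(3\le j\le l-2),\\ &\triangle u_{l-1}=e^{u_{l-1}-u_{l-2}}-e^{u_l-u_{l-1}}-e^{-u_l-u_{l-1}},\qquad \triangle u_l=e^{u_l-u_{l-1}}-e^{-u_l-u_{l-1}}. \end{aligned}$$ Consider $2l\times 2l$ matrices divided into $N\times N$ blocks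 of sizes $r_j\times r_k$, where $r_1=r_l=2$ and all other $r_j=1$. Let $J$ be the matrix all of whose entries in the blocks $J_{j,j+1}$ ($j$ modulo $N$) are $1$ and whose other entries are $0$. Let $V$ be the diagonal matrix with $V_{11}=\mathrm{diag}(e^{-u_1},e^{u_1})$, $V_{ll}=\mathrm{diag}(e^{u_l},e^{-u_l})$, and $V_{jj}=e^{u_j}$, $V_{2l-j,2l-j}=e^{-u_j}$ for $2\le j\le l-1$. The Lax pair with parameter $\lambda$ is $$\Phi_z=(\lambda J+V_zV^{-1})\Phi,\qquad \Phi_{\bar z}=\lambda^{-1}VJ^TV^{-1}\Phi .$$ Let $(u_1,\dots,u_l)$ be a solution of the Toda equation on $U$, let $\mu\in\mathbb C$ with $\mu\ne0$, $|\mu|\ne1$, and let $H=(h_1,\dots,h_N)^T$ be a column solution on $U$ of the Lax pair with $\lambda=\mu$, where $h_1=(h_{11},h_{12})^T$, $h_l=(h_{l1},h_{l2})^T$ and the other $h_j$ are scalar functions, such that on $U$ $$h_{11}h_{12}+(-1)^{l-1}h_{l1}h_{l2}+\sum_{c=2}^{l-1}(-1)^{c-1}h_ch_{2-c}=0 .$$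 For every integer $j$ put $$\begin{aligned} \gamma_j=\frac1{1-|\mu|^{4l-4}}\Big(&(-|\mu|^2)^{\{j-1\}}(|h_{11}|^2e^{u_1}+|h_{12}|^2e^{-u_1})+(-|\mu|^2)^{\{j+l-2\}}(|h_{l1}|^2e^{-u_l}+|h_{l2}|^2e^{u_l})\\ &+\sum_{c=2}^{l-1}(-|\mu|^2)^{\{j+c-2\}}|h_c|^2e^{-u_c}+\sum_{c=2}^{l-1}(-|\mu|^2)^{\{j-c\}}|h_{2-c}|^2e^{u_c}\Big), \end{aligned}$$ $$\begin{aligned} g_j=\frac1{(2l-2)^2}\Big|&2\{1-j\}h_{11}h_{12}+2(-1)^{l-1}\{l-j\}h_{l1}h_{l2}\\ &+\sum_{\substack{c=2\\ c\ne l}}^{2l-2}(-1)^{c+1}\{c-j\}h_{2-c}h_c\Big|^2-|\mu|^2\gamma_{j-1}\gamma_{2-j}. \end{aligned}$$ Assume that at every point of $U$ the arguments of the logarithms below are defined (non-zero denominators) and positive. Then $$\tilde u_1=u_1-\ln\frac{|h_{11}|^2e^{u_1}-\gamma_1}{|h_{12}|^2e^{-u_1}-\gamma_1},\qquad \tilde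 u_j=u_j+\ln\frac{g_{j+1}}{g_j}\ (2\le j\le l-1),\qquad \tilde u_l=u_l+\ln\frac{|h_{l1}|^2e^{-u_l}-\gamma_l}{|h_{l2}|^2e^{u_l}-\gamma_l}$$ are $C^2$ on $U$ and $(\tilde u_1,\dots,\tilde u_l)$ is again a solution of the elliptic $D_l^{(1)}$ Toda equation on $U$. -/

import Mathlib

open scoped Laplacian

namespace EllipticToda

/-- The plane `ℝ²` is identified with `ℂ` through `w = x + i y`. The complex coordinate used in the
Lax pair is `z = (x + i y) / 2`, so that `∂_z = ∂_x - i ∂_y`, `∂_{z̄} = ∂_x + i ∂_y` and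
`∂_z ∂_{z̄}` is the usual Laplacian `∂_x² + ∂_y²`. -/
noncomputable def dz (f : ℂ → ℂ) (w : ℂ) : ℂ :=
  fderiv ℝ f w 1 - Complex.I * fderiv ℝ f w Complex.I

/-- `∂_{z̄} = ∂_x + i ∂_y` for `z = (x + i y) / 2`. -/
noncomputable def dzbar (f : ℂ → ℂ) (w : ℂ) : ℂ :=
  fderiv ℝ f w 1 + Complex.I * fderiv ℝ f w Complex.I

/-- `u_1, …, u_l` is a (classical, `C²`) solution on `U` of the two dimensional elliptic `D_l^{(1)}`
Toda equation; only the values `u 1, …, u l` of the family `u` matter. -/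
structure IsTodaSolution (l : ℕ) (U : Set ℂ) (u : ℕ → ℂ → ℝ) : Prop where
  contDiffOn : ∀ j ∈ Finset.Icc 1 l, ContDiffOn ℝ 2 (u j) U
  eq_one : ∀ w ∈ U, Δ (u 1) w = Real.exp (u 2 w + u 1 w) - Real.exp (u 2 w - u 1 w)
  eq_two : ∀ w ∈ U, Δ (u 2) w =
    Real.exp (u 2 w + u 1 w) + Real.exp (u 2 w - u 1 w) - Real.exp (u 3 w - u 2 w)
  eq_mid : ∀ j ∈ Finset.Icc 3 (l - 2), ∀ w ∈ U, Δ (u j) w =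
    Real.exp (u j w - u (j - 1) w) - Real.exp (u (j + 1) w - u j w)
  eq_penultimate : ∀ w ∈ U, Δ (u (l - 1)) w =
    Real.exp (u (l - 1) w - u (l - 2) w) - Real.exp (u l w - u (l - 1) w)
      - Real.exp (-u l w - u (l - 1) w)
  eq_last : ∀ w ∈ U, Δ (u l) w =
    Real.exp (u l w - u (l - 1) w) - Real.exp (-u l w - u (l - 1) w)

/-- The rows (and columns) of the Lax matrices. With `N = 2 l - 2`, the index `inl j` is the first
row of the `j`-th block (`j` modulo `N`), `inr 0` is the second row of block `1` and `inr 1` is the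
second row of block `l`; all other blocks have one row. -/
abbrev LaxIdx (l : ℕ) : Type := ZMod (2 * l - 2) ⊕ Fin 2

instance (l : ℕ) [h : Fact (4 ≤ l)] : NeZero (2 * l - 2) :=
  ⟨by have := h.out; omega⟩

/-- The block to which a row belongs. -/
def block (l : ℕ) : LaxIdx l → ZMod (2 * l - 2)
  | Sum.inl j => j
  | Sum.inr 0 => 1
  | Sum.inr 1 => (l : ZMod (2 * l - 2))

/-- The matrix `J`: all entries of the blocks `J_{j,j+1}` (`j` modulo `N`) are `1`, all other
entries are `0`. -/
def J (l : ℕ) : Matrix (LaxIdx l) (LaxIdx l) ℂ :=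
  Matrix.of fun a b => if block l b = block l a + 1 then 1 else 0

/-- The logarithms of the diagonal entries of `V`: they are `(-u_1, u_1)` in block `1`,
`(u_l, -u_l)` in block `l`, `u_j` in block `j` and `-u_j` in block `2 - j` for `2 ≤ j ≤ l - 1`. -/
def logV (l : ℕ) (u : ℕ → ℂ → ℝ) (w : ℂ) : LaxIdx l → ℝ
  | Sum.inl j =>
      if j = 1 then -u 1 w
      else if j = (l : ZMod (2 * l - 2)) then u l w
      else if 2 ≤ j.val ∧ j.val ≤ l - 1 then u j.val w
      else -u (2 - j).val w
  | Sum.inr 0 => u 1 w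
  | Sum.inr 1 => -u l w

/-- The real diagonal matrix `V`. -/
noncomputable def V (l : ℕ) (u : ℕ → ℂ → ℝ) (w : ℂ) : Matrix (LaxIdx l) (LaxIdx l) ℂ :=
  Matrix.diagonal fun a => (Real.exp (logV l u w a) : ℂ)

/-- `P = V_z V⁻¹`. -/
noncomputable def P (l : ℕ) [Fact (4 ≤ l)] (u : ℕ → ℂ → ℝ) (w : ℂ) :
    Matrix (LaxIdx l) (LaxIdx l) ℂ :=
  (Matrix.of fun a b => dz (fun w' => V l u w' a b) w) * (V l u w)⁻¹

/-- `Q = V Jᵀ V⁻¹`. -/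
noncomputable def Q (l : ℕ) [Fact (4 ≤ l)] (u : ℕ → ℂ → ℝ) (w : ℂ) :
    Matrix (LaxIdx l) (LaxIdx l) ℂ :=
  V l u w * (J l).transpose * (V l u w)⁻¹

/-- `H` is a column solution on `U` of the Lax pair `Φ_z = (λ J + P) Φ`, `Φ_{z̄} = λ⁻¹ Q Φ` with
`λ = μ`. -/
structure IsLaxSolution (l : ℕ) [Fact (4 ≤ l)] (U : Set ℂ) (u : ℕ → ℂ → ℝ) (μ : ℂ)
    (H : ℂ → LaxIdx l → ℂ) : Prop where
  differentiableOn : DifferentiableOn ℝ H U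
  eq_z : ∀ w ∈ U, (fun a => dz (fun w' => H w' a) w) = (μ • J l + P l u w).mulVec (H w)
  eq_zbar : ∀ w ∈ U, (fun a => dzbar (fun w' => H w' a) w) = ((1 / μ) • Q l u w).mulVec (H w)

section Formulas

variable (l : ℕ) (μ : ℂ) (u : ℕ → ℂ → ℝ) (H : ℂ → LaxIdx l → ℂ) (w : ℂ)

/-- `h_j`, for an integer `j` modulo `N`: the entry of `H` in block `j`, or the first of its two
entries (`h_{11}`, `h_{l1}`) if `j ≡ 1` or `j ≡ l`. -/
def h (j : ℤ) : ℂ := H w (Sum.inl (j : ZMod (2 * l - 2)))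

/-- `h_{12}`. -/
def h12 : ℂ := H w (Sum.inr 0)

/-- `h_{l2}`. -/
def hl2 : ℂ := H w (Sum.inr 1)

/-- `{k}`, the remainder of `k` divided by `N = 2 l - 2`. -/
def rem (k : ℤ) : ℕ := (k % (2 * (l : ℤ) - 2)).toNat

/-- The quadratic form
`h_{11} h_{12} + (-1)^{l-1} h_{l1} h_{l2} + ∑_{c=2}^{l-1} (-1)^{c-1} h_c h_{2-c}`. -/
def constraintForm : ℂ :=
  h l H w 1 * h12 l H w + (-1) ^ (l - 1) * (h l H w l * hl2 l H w)
    + ∑ c ∈ Finset.Icc 2 (l - 1), (-1) ^ (c - 1) * (h l H w c * h l H w (2 - c))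

/-- The functions `γ_j`. -/
noncomputable def gam (j : ℤ) : ℝ :=
  1 / (1 - ‖μ‖ ^ (4 * l - 4)) *
    ((-‖μ‖ ^ 2) ^ rem l (j - 1) *
        (‖h l H w 1‖ ^ 2 * Real.exp (u 1 w) + ‖h12 l H w‖ ^ 2 * Real.exp (-u 1 w))
      + (-‖μ‖ ^ 2) ^ rem l (j + l - 2) *
        (‖h l H w l‖ ^ 2 * Real.exp (-u l w) + ‖hl2 l H w‖ ^ 2 * Real.exp (u l w))
      + ∑ c ∈ Finset.Icc 2 (l - 1),
          (-‖μ‖ ^ 2) ^ rem l (j + c - 2) * (‖h l H w c‖ ^ 2 * Real.exp (-u c w))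
      + ∑ c ∈ Finset.Icc 2 (l - 1),
          (-‖μ‖ ^ 2) ^ rem l (j - c) * (‖h l H w (2 - c)‖ ^ 2 * Real.exp (u c w)))

/-- The functions `g_j`. -/
noncomputable def g (j : ℤ) : ℝ :=
  1 / (2 * (l : ℝ) - 2) ^ 2 *
      ‖2 * (rem l (1 - j) : ℂ) * (h l H w 1 * h12 l H w)
        + 2 * (-1) ^ (l - 1) * (rem l (l - j) : ℂ) * (h l H w l * hl2 l H w)
        + ∑ c ∈ (Finset.Icc 2 (2 * l - 2)).erase l,
            (-1) ^ (c + 1) * (rem l (c - j) : ℂ) * (h l H w (2 - c) * h l H w c)‖ ^ 2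
    - ‖μ‖ ^ 2 * gam l μ u H w (j - 1) * gam l μ u H w (2 - j)

/-- `(|h_{11}|² e^{u_1} - γ_1) / (|h_{12}|² e^{-u_1} - γ_1)`. -/
noncomputable def ratioFirst : ℝ :=
  (‖h l H w 1‖ ^ 2 * Real.exp (u 1 w) - gam l μ u H w 1) /
    (‖h12 l H w‖ ^ 2 * Real.exp (-u 1 w) - gam l μ u H w 1)

/-- `(|h_{l1}|² e^{-u_l} - γ_l) / (|h_{l2}|² e^{u_l} - γ_l)`. -/
noncomputable def ratioLast : ℝ :=
  (‖h l H w l‖ ^ 2 * Real.exp (-u l w) - gam l μ u H w l) /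
    (‖hl2 l H w‖ ^ 2 * Real.exp (u l w) - gam l μ u H w l)

end Formulas

/-- The transformed functions `ũ_1, …, ũ_l`. As the first entry of block `1` of `V` is `e^{-u_1}`,
the logarithm enters `ũ_1` with a minus sign. -/
noncomputable def newU (l : ℕ) (μ : ℂ) (u : ℕ → ℂ → ℝ) (H : ℂ → LaxIdx l → ℂ)
    (j : ℕ) (w : ℂ) : ℝ :=
  if j = 1 then u 1 w - Real.log (ratioFirst l μ u H w)
  else if j = l then u l w + Real.log (ratioLast l μ u H w)
  else u j w + Real.log (g l μ u H w (j + 1) / g l μ u H w j)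

end EllipticToda

/-! Let σ be the reflection of the rows that exchanges the blocks j and 2 - j and inverts V. Let S_j
and T_j be the sums over block j of the entries of H and of V⁻¹H (`colSum`, `dualSum`), n_j the sum
of |h_a|²/v_a (`normSum`) and p_j the sum of h_a h_{σa} (`pairSum`). The term V_z V⁻¹ drops out of
the derivatives of n_j and p_j, which become combinations of neighbouring terms of the cycle of
blocks. The functions γ_j and q_j (`quadSum`) are the weighted cyclic sums of n and p in which these
combinations telescope: γ_{j+1} = -|μ|² γ_j + n_{1-j}, ∂_z γ_j = μ̄⁻¹ S_{2-j} conj T_{1-j}; q_{j+1}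
= q_j - (-1)^j p_j, ∂_z q_j = μ (-1)^j S_j S_{3-j}. The quadratic constraint on H is the condition
that the recurrence for q closes up around the cycle; it also gives q_{3-j} = -q_j.

Hence g_j = |q_j|² - |μ|² γ_{j-1} γ_{2-j} satisfies g_{3-j} = g_j, and g_{j+1} - g_j is explicit
across a block of size one (`gfun_add_one`). The product of this step and its mirror image is
compared with g_j ∂_z̄∂_z g_j - |∂_z g_j|². The outcome is Hirota's equation Δ log|g_j| = (v_j /
v_{j-1}) (1 - g_{j+1} g_{j-1} / g_j²) (`laplacian_log_gfun`).

The blocks c = 1 and c = l of size two are fixed by the reflection. There g_{c+1} is the product of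
the two functions |h_a|²/v_a - γ_c, a running over the two rows (`gfun_pair`), and each factor D
satisfies Δ log|D| = (v_{c+1} / v_a) (1 - g_{c+2} / D²) (`laplacian_log_pair`).

The new functions are the old ones plus logarithms of ratios of g_j or of these factors. In their
Laplacians the constants 1 of the bilinear equations cancel the old Toda terms, and what remains is
the exponentials of the new functions (`IsTodaSolution.of_hirota`). H is only assumed
differentiable; the Lax pair itself makes it C² (`contDiffOn_col`). -/

namespace EllipticToda

open scoped ComplexConjugate

/-! ### Wirtinger calculus and the Laplacian of a logarithm. -/

/-- The real linear map `a dz + b dz̄`, where `z = (x + i y) / 2`. -/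
noncomputable def wirtinger (a b : ℂ) : ℂ →L[ℝ] ℂ :=
  (a / 2) • (1 : ℂ →L[ℝ] ℂ) + (b / 2) • (Complex.conjCLE : ℂ →L[ℝ] ℂ)

@[simp] lemma wirtinger_apply (a b v : ℂ) :
    wirtinger a b v = a / 2 * v + b / 2 * conj v := by
  simp [wirtinger]

/-- `f` is real differentiable at `w` with `∂_z f = a` and `∂_{z̄} f = b`. -/
def HasWirtingerAt (f : ℂ → ℂ) (a b w : ℂ) : Prop :=
  HasFDerivAt f (wirtinger a b) w

namespace HasWirtingerAt

variable {f g : ℂ → ℂ} {a b c d w : ℂ}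

lemma dz_eq (hf : HasWirtingerAt f a b w) : dz f w = a := by
  rw [dz, HasFDerivAt.fderiv hf]
  simp
  linear_combination (-(a - b) / 2) * Complex.I_mul_I

lemma dzbar_eq (hf : HasWirtingerAt f a b w) : dzbar f w = b := by
  rw [dzbar, HasFDerivAt.fderiv hf]
  simp
  linear_combination ((a - b) / 2) * Complex.I_mul_I

lemma of_differentiableAt (hf : DifferentiableAt ℝ f w) :
    HasWirtingerAt f (dz f w) (dzbar f w) w := by
  have key : fderiv ℝ f w = wirtinger (dz f w) (dzbar f w) := by
    ext v
    have hv : v = v.re • (1 : ℂ) + v.im • Complex.I := by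
      simp [Complex.re_add_im]
    rw [hv, map_add, map_add, map_smul, map_smul, map_smul, map_smul, wirtinger_apply,
      wirtinger_apply, dz, dzbar]
    simp
    linear_combination (v.im * fderiv ℝ f w Complex.I) * Complex.I_mul_I
  rw [HasWirtingerAt, ← key]
  exact hf.hasFDerivAt

lemma congr_deriv (hf : HasWirtingerAt f a b w) (h₁ : a = c) (h₂ : b = d) :
    HasWirtingerAt f c d w := by
  subst h₁ h₂; exact hf

lemma const (k w : ℂ) : HasWirtingerAt (fun _ => k) 0 0 w := by
  have : wirtinger 0 0 = 0 := by ext v; simp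
  rw [HasWirtingerAt, this]
  exact hasFDerivAt_const k w

lemma add (hf : HasWirtingerAt f a b w) (hg : HasWirtingerAt g c d w) :
    HasWirtingerAt (fun w => f w + g w) (a + c) (b + d) w := by
  have : wirtinger (a + c) (b + d) = wirtinger a b + wirtinger c d := by ext v; simp; ring
  rw [HasWirtingerAt, this]
  exact HasFDerivAt.add hf hg

lemma mul (hf : HasWirtingerAt f a b w) (hg : HasWirtingerAt g c d w) :
    HasWirtingerAt (fun w => f w * g w) (a * g w + f w * c) (b * g w + f w * d) w := by
  have : wirtinger (a * g w + f w * c) (b * g w + f w * d)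
      = f w • wirtinger c d + g w • wirtinger a b := by ext v; simp; ring
  rw [HasWirtingerAt, this]
  exact HasFDerivAt.mul hf hg

lemma const_mul (k : ℂ) (hf : HasWirtingerAt f a b w) :
    HasWirtingerAt (fun w => k * f w) (k * a) (k * b) w :=
  ((const k w).mul hf).congr_deriv (by ring) (by ring)

lemma sub (hf : HasWirtingerAt f a b w) (hg : HasWirtingerAt g c d w) :
    HasWirtingerAt (fun w => f w - g w) (a - c) (b - d) w := by
  have := hf.add (hg.const_mul (-1))
  convert this.congr_deriv (c := a - c) (d := b - d) (by ring) (by ring) using 1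
  ext w; ring

lemma sum {ι : Type*} {s : Finset ι} {f : ι → ℂ → ℂ} {a b : ι → ℂ}
    (hf : ∀ i ∈ s, HasWirtingerAt (f i) (a i) (b i) w) :
    HasWirtingerAt (fun w => ∑ i ∈ s, f i w) (∑ i ∈ s, a i) (∑ i ∈ s, b i) w := by
  have : wirtinger (∑ i ∈ s, a i) (∑ i ∈ s, b i) = ∑ i ∈ s, wirtinger (a i) (b i) := by
    ext v; simp [Finset.sum_add_distrib, Finset.sum_mul, Finset.sum_div]
  rw [HasWirtingerAt, this]
  exact HasFDerivAt.fun_sum hf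

lemma star (hf : HasWirtingerAt f a b w) :
    HasWirtingerAt (fun w => conj (f w)) (conj b) (conj a) w := by
  have : wirtinger (conj b) (conj a) = (Complex.conjCLE : ℂ →L[ℝ] ℂ).comp (wirtinger a b) := by
    ext v; simp [Complex.conj_ofNat]; ring
  rw [HasWirtingerAt, this]
  exact (Complex.conjCLE : ℂ →L[ℝ] ℂ).hasFDerivAt.comp w hf

lemma comp_holomorphic {φ : ℂ → ℂ} {φ' : ℂ} (hφ : HasDerivAt φ φ' (f w))
    (hf : HasWirtingerAt f a b w) : HasWirtingerAt (fun w => φ (f w)) (φ' * a) (φ' * b) w := by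
  have h1 := (hφ.hasFDerivAt.restrictScalars ℝ).comp w hf
  have h2 : wirtinger (φ' * a) (φ' * b)
      = ((ContinuousLinearMap.toSpanSingleton ℂ φ').restrictScalars ℝ).comp (wirtinger a b) := by
    ext v; simp; ring
  rw [HasWirtingerAt, h2]
  exact h1

lemma inv (hf : HasWirtingerAt f a b w) (h0 : f w ≠ 0) :
    HasWirtingerAt (fun w => (f w)⁻¹) (-a / f w ^ 2) (-b / f w ^ 2) w :=
  (comp_holomorphic (hasDerivAt_inv h0) hf).congr_deriv (by ring) (by ring)

lemma continuousAt (hf : HasWirtingerAt f a b w) : ContinuousAt f w :=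
  HasFDerivAt.continuousAt hf

/-- The logarithm of the absolute value of a real function. -/
lemma log_ofReal {f : ℂ → ℝ} (hf : HasWirtingerAt (fun w => (f w : ℂ)) a b w) (h0 : f w ≠ 0) :
    HasWirtingerAt (fun w => (Real.log (f w) : ℂ)) (a / f w) (b / f w) w := by
  have h1 : HasFDerivAt f (Complex.reCLM.comp (wirtinger a b)) w := by
    have := Complex.reCLM.hasFDerivAt.comp w hf
    simpa [Function.comp_def] using this
  have h2 := Complex.ofRealCLM.hasFDerivAt.comp w (h1.log h0)
  have h3 : wirtinger a b = Complex.ofRealCLM.comp (Complex.reCLM.comp (wirtinger a b)) :=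
    HasFDerivAt.unique hf (Complex.ofRealCLM.hasFDerivAt.comp w h1)
  have h4 : wirtinger (a / f w) (b / f w) =
      Complex.ofRealCLM.comp ((f w)⁻¹ • Complex.reCLM.comp (wirtinger a b)) := by
    ext v
    have h5 := congrArg (fun L : ℂ →L[ℝ] ℂ => L v) h3
    simp only [wirtinger_apply, ContinuousLinearMap.comp_apply, Complex.ofRealCLM_apply,
      _root_.smul_apply, smul_eq_mul, Complex.ofReal_mul, Complex.ofReal_inv] at h5 ⊢
    rw [← h5]; ring
  rw [HasWirtingerAt, h4]
  exact h2

end HasWirtingerAt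

/-- The Laplacian of a real function is `∂_{z̄} ∂_z`. -/
lemma laplacian_eq_re {f : ℂ → ℝ} {E E' : ℂ → ℂ} {X F w : ℂ}
    (hf : ∀ᶠ w' in nhds w, HasWirtingerAt (fun w => (f w : ℂ)) (E w') (E' w') w')
    (hE : HasWirtingerAt E X F w) : Δ f w = F.re := by
  -- For real f the derivative is v ↦ Re(E v), so `E` alone determines the second derivative.
  have h1 : fderiv ℝ f =ᶠ[nhds w] fun w' =>
      Complex.reCLM.comp (ContinuousLinearMap.mul ℝ ℂ (E w')) := by
    filter_upwards [hf] with w' hw'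
    have h2 : HasFDerivAt f (Complex.reCLM.comp (wirtinger (E w') (E' w'))) w' := by
      have := Complex.reCLM.hasFDerivAt.comp w' hw'
      simpa [Function.comp_def] using this
    have h3 := HasFDerivAt.unique hw' (Complex.ofRealCLM.hasFDerivAt.comp w' h2)
    have e1 := congrArg (fun L : ℂ →L[ℝ] ℂ => (L 1).im) h3
    have e2 := congrArg (fun L : ℂ →L[ℝ] ℂ => (L Complex.I).im) h3
    simp at e1 e2
    rw [h2.fderiv]
    ext v
    simp [Complex.mul_re]
    linear_combination -v.re * e2 + v.im * e1
  have h2 : HasFDerivAt (fun w' => Complex.reCLM.comp (ContinuousLinearMap.mul ℝ ℂ (E w')))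
      ((ContinuousLinearMap.compL ℝ ℂ ℂ ℝ Complex.reCLM).comp
        ((ContinuousLinearMap.mul ℝ ℂ).comp (wirtinger X F))) w :=
    (ContinuousLinearMap.compL ℝ ℂ ℂ ℝ Complex.reCLM).hasFDerivAt.comp w
      ((ContinuousLinearMap.mul ℝ ℂ).hasFDerivAt.comp w hE)
  rw [InnerProductSpace.laplacian_eq_iteratedFDeriv_complexPlane]
  simp only [iteratedFDeriv_two_apply]
  rw [h1.fderiv_eq, h2.fderiv]
  simp [Complex.mul_re]
  ring

/-- The form in which bilinear equations are used: Δ log f is (f ∂_z̄∂_z f - |∂_z f|²) / f². Only `f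
w ≠ 0` is needed, since `Real.log` is the logarithm of the absolute value; g_j and its factors may
be negative. -/
lemma laplacian_log_eq {f : ℂ → ℝ} {E : ℂ → ℂ} {X F w : ℂ}
    (hf : ∀ᶠ w' in nhds w, HasWirtingerAt (fun w => (f w : ℂ)) (E w') (conj (E w')) w')
    (hE : HasWirtingerAt E X F w) (h0 : f w ≠ 0) {k r : ℝ}
    (hk : f w * F - E w * conj (E w) = k * ((f w : ℂ) ^ 2 - r)) :
    Δ (fun w => Real.log (f w)) w = k * (1 - r / f w ^ 2) := by
  have hc : ContinuousAt f w := by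
    have := Complex.continuous_re.continuousAt.comp hf.self_of_nhds.continuousAt
    simpa [Function.comp_def] using this
  have hne : ∀ᶠ w' in nhds w, f w' ≠ 0 := hc.eventually_ne h0
  have h1 : ∀ᶠ w' in nhds w, HasWirtingerAt (fun w => (Real.log (f w) : ℂ))
      (E w' * (f w' : ℂ)⁻¹) (conj (E w') / f w') w' := by
    filter_upwards [hf, hne] with w' hw' hn
    exact hw'.log_ofReal hn
  have h0' : (f w : ℂ) ≠ 0 := by exact_mod_cast h0
  have h2 := hE.mul (hf.self_of_nhds.inv h0')
  rw [laplacian_eq_re h1 h2]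
  have : F * (f w : ℂ)⁻¹ + E w * (-conj (E w) / (f w : ℂ) ^ 2)
      = ((k * (1 - r / f w ^ 2) : ℝ) : ℂ) := by
    push_cast
    field_simp
    linear_combination hk
  rw [this, Complex.ofReal_re]

/-! ### Weighted sums around a cycle. -/

section Cyclic

variable {N : ℕ}

/-- The sign `(-1)^j`, for `j` modulo the even number `N`. -/
noncomputable def sgn (j : ZMod N) : ℂ := (-1) ^ j.val

lemma sgn_mul_self (j : ZMod N) : sgn j * sgn j = 1 := by
  rw [sgn, ← mul_pow]; simp

lemma conj_sgn (j : ZMod N) : conj (sgn j) = sgn j := by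
  simp [sgn]

lemma sgn_natCast (hN : Even N) (k : ℕ) : sgn (k : ZMod N) = (-1) ^ k := by
  rw [sgn, ZMod.val_natCast]
  conv_rhs => rw [← Nat.mod_add_div k N, pow_add, pow_mul, hN.neg_one_pow, one_pow, mul_one]

lemma sgn_one (hN : Even N) : sgn (1 : ZMod N) = -1 := by
  have := sgn_natCast hN 1
  simpa using this

variable [NeZero N]

lemma sgn_add (hN : Even N) (i j : ZMod N) : sgn (i + j) = sgn i * sgn j := by
  conv_lhs => rw [← ZMod.natCast_zmod_val i, ← ZMod.natCast_zmod_val j, ← Nat.cast_add]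
  rw [sgn_natCast hN, pow_add, sgn, sgn]

lemma sgn_add_one (hN : Even N) (j : ZMod N) : sgn (j + 1) = -sgn j := by
  rw [sgn_add hN, sgn_one hN]; ring

lemma sgn_neg (hN : Even N) (j : ZMod N) : sgn (-j) = sgn j := by
  have h1 : sgn (-j) * sgn j = 1 := by
    rw [← sgn_add hN, neg_add_cancel]; simp [sgn]
  linear_combination (sgn j) * h1 - sgn (-j) * sgn_mul_self j

lemma sgn_two_sub (hN : Even N) (j : ZMod N) : sgn (2 - j) = sgn j := by
  have : 2 - j = -j + 1 + 1 := by ring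
  rw [this, sgn_add_one hN, sgn_add_one hN, neg_neg, sgn_neg hN]

lemma sgn_three_sub (hN : Even N) (j : ZMod N) : sgn (3 - j) = -sgn j := by
  have : 3 - j = -j + 1 + 1 + 1 := by ring
  rw [this, sgn_add_one hN, sgn_add_one hN, sgn_add_one hN, neg_neg, sgn_neg hN]

/-- The remainder grows by one except at the wrap-around k = -1, where it drops by N - 1. This
single jump isolates one term of a cyclic sum in the lemmas on `quad`. -/
lemma val_add_one_eq (k : ZMod N) :
    ((k + 1).val : ℂ) = k.val + 1 - if k = -1 then (N : ℂ) else 0 := by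
  have h1 : (k + 1).val = (k.val + 1) % N := by
    rw [ZMod.val_add, ZMod.val_one_eq_one_mod, Nat.add_mod_mod]
  have h2 : k = -1 ↔ (k.val + 1) % N = 0 := by
    rw [← h1, ZMod.val_eq_zero, add_eq_zero_iff_eq_neg]
  have h3 := ZMod.val_lt k
  by_cases h4 : k.val + 1 = N
  · have h5 : (k.val : ℂ) + 1 = N := by exact_mod_cast congrArg (Nat.cast (R := ℂ)) h4
    rw [h1, if_pos (h2.mpr (by rw [h4, Nat.mod_self])), h4, Nat.mod_self, h5]
    simp
  · have h5 : (k.val + 1) % N = k.val + 1 := Nat.mod_eq_of_lt (by omega)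
    rw [h1, if_neg (by rw [h2, h5]; omega), h5]
    push_cast; ring

lemma val_neg_one_add_one : (-1 : ZMod N).val + 1 = N := by
  have := val_add_one_eq (-1 : ZMod N)
  rw [if_pos rfl, neg_add_cancel, ZMod.val_zero, Nat.cast_zero] at this
  have : (((-1 : ZMod N).val + 1 : ℕ) : ℂ) = (N : ℂ) := by
    push_cast; linear_combination -this
  exact_mod_cast this

/-- The wrap-around defect 1 - m^N is the constant by which `cyc` divides. -/
lemma pow_val_add_one (m : ℂ) (k : ZMod N) :
    m ^ (k + 1).val = m * m ^ k.val + if k = -1 then 1 - m ^ N else 0 := by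
  split_ifs with h0
  · subst h0
    rw [← pow_succ', val_neg_one_add_one]; simp
  · have := val_add_one_eq k
    rw [if_neg h0] at this
    have : (k + 1).val = k.val + 1 := by
      have : ((k + 1).val : ℂ) = ((k.val + 1 : ℕ) : ℂ) := by rw [this]; push_cast; ring
      exact_mod_cast this
    rw [this, pow_succ']; ring

/-- The `N`-periodic solution of `γ_{j+1} = m γ_j + w_{1-j}`. -/
noncomputable def cyc (m : ℂ) (f : ZMod N → ℂ) (j : ZMod N) : ℂ :=
  1 / (1 - m ^ N) * ∑ c, m ^ (j + c - 2).val * f c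

lemma cyc_add_one {m : ℂ} (hm : m ^ N ≠ 1) (f : ZMod N → ℂ) (j : ZMod N) :
    cyc m f (j + 1) = m * cyc m f j + f (1 - j) := by
  have h0 : (1 - m ^ N) ≠ 0 := sub_ne_zero.mpr hm.symm
  have e : ∀ c : ZMod N, m ^ (j + 1 + c - 2).val * f c = m * (m ^ (j + c - 2).val * f c)
      + if c = 1 - j then (1 - m ^ N) * f c else 0 := by
    intro c
    have h1 : j + 1 + c - 2 = (j + c - 2) + 1 := by ring
    have h2 : j + c - 2 = -1 ↔ c = 1 - j := by
      constructor <;> intro h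
      · linear_combination h
      · linear_combination h
    rw [h1, pow_val_add_one]
    simp only [h2]
    split_ifs <;> ring
  simp only [cyc, e, Finset.sum_add_distrib, ← Finset.mul_sum, Finset.sum_ite_eq',
    Finset.mem_univ, if_true]
  field_simp

/-- A source that is a twisted difference telescopes: -e (1 - j) / m solves the recurrence of
`cyc_add_one` for it. This collapses the derivative of γ_j to one product. -/
lemma cyc_sub_shift {m : ℂ} (hm0 : m ≠ 0) (hm : m ^ N ≠ 1) (e : ZMod N → ℂ) (j : ZMod N) :
    cyc m (fun c => e c - e (c - 1) / m) j = -e (1 - j) / m := by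
  have h0 : (1 - m ^ N) ≠ 0 := sub_ne_zero.mpr hm.symm
  have s1 : ∑ c, m ^ (j + c - 2).val * (e (c - 1) / m)
      = ∑ c, m ^ (j + c - 2 + 1).val * (e c / m) := by
    rw [← Equiv.sum_comp (Equiv.addRight (1 : ZMod N))]
    refine Finset.sum_congr rfl fun c _ => ?_
    simp only [Equiv.coe_addRight]
    congr 3 <;> ring_nf
  have h2 : ∀ c : ZMod N, j + c - 2 = -1 ↔ c = 1 - j := by
    intro c
    constructor <;> intro h
    · linear_combination h
    · linear_combination h
  have s2 : ∀ c : ZMod N, m ^ (j + c - 2 + 1).val * (e c / m) = m ^ (j + c - 2).val * e c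
      + if c = 1 - j then (1 - m ^ N) * (e c / m) else 0 := by
    intro c
    rw [pow_val_add_one]
    simp only [h2]
    split_ifs <;> field_simp
    ring
  simp only [cyc, mul_sub, Finset.sum_sub_distrib, s1]
  simp only [s2, Finset.sum_add_distrib, Finset.sum_ite_eq', Finset.mem_univ, if_true]
  field_simp
  ring

/-- The mean `N⁻¹ ∑_c (-1)^{c+1} {c-j} p_c`. -/
noncomputable def quad (p : ZMod N → ℂ) (j : ZMod N) : ℂ :=
  1 / (N : ℂ) * ∑ c, sgn (c + 1) * (c - j).val * p c

/-- Moving j to j + 1 lowers every remainder by one, which costs a multiple of the alternating sum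
and hence nothing; the wrap-around at c = j leaves the local term. -/
lemma quad_add_one (hN : Even N) {p : ZMod N → ℂ} (hp : ∑ c, sgn c * p c = 0) (j : ZMod N) :
    quad p (j + 1) = quad p j - sgn j * p j := by
  have hN0 : (N : ℂ) ≠ 0 := by exact_mod_cast NeZero.ne N
  have e : ∀ c : ZMod N, sgn (c + 1) * (c - j).val * p c
      = sgn (c + 1) * (c - (j + 1)).val * p c - sgn c * p c
        + if c = j then N * (sgn c * p c) else 0 := by
    intro c
    have h1 : c - j = c - (j + 1) + 1 := by ring
    have h2 : c - (j + 1) = -1 ↔ c = j := by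
      constructor <;> intro h
      · linear_combination h
      · linear_combination h
    rw [h1, val_add_one_eq]
    simp only [h2, sgn_add_one hN]
    split_ifs <;> ring
  simp only [quad]
  simp only [e, Finset.sum_add_distrib, Finset.sum_sub_distrib, hp, Finset.sum_ite_eq',
    Finset.mem_univ, if_true]
  field_simp
  ring

/-- The substitution c ↦ 2 - c turns the remainder k into N - 1 - k; the constant N - 1 multiplies
the alternating sum, which vanishes. -/
lemma quad_three_sub (hN : Even N) {p : ZMod N → ℂ} (hp : ∑ c, sgn c * p c = 0)
    (hs : ∀ c, p (2 - c) = p c) (j : ZMod N) : quad p (3 - j) = -quad p j := by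
  have e : ∑ c, sgn (c + 1) * (c - (3 - j)).val * p c
      = ∑ c, (sgn c * p c * (-(N - 1 : ℂ)) - sgn (c + 1) * (c - j).val * p c) := by
    rw [← Equiv.sum_comp (Equiv.subLeft (2 : ZMod N))]
    refine Finset.sum_congr rfl fun c _ => ?_
    simp only [Equiv.subLeft_apply, hs]
    have h1 : 2 - c - (3 - j) = -(c - j) - 1 := by ring
    have h2 : ∀ k : ZMod N, ((-k - 1).val : ℂ) = N - 1 - k.val := by
      intro k
      have h3 := val_add_one_eq (-k - 1)
      rw [sub_add_cancel] at h3
      by_cases hk : k = 0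
      · subst hk
        simp at h3
        simp; linear_combination -h3
      · rw [if_neg (by simpa [sub_eq_neg_self] using hk)] at h3
        have h4 : ((-k).val : ℂ) = N - k.val := by
          rw [ZMod.neg_val, if_neg hk, Nat.cast_sub (ZMod.val_lt k).le]
        linear_combination -h3 + h4
    have h5 : 2 - c + 1 = 3 - c := by ring
    rw [h1, h2, h5, sgn_three_sub hN, sgn_add_one hN]
    ring
  rw [quad, e, Finset.sum_sub_distrib, ← Finset.sum_mul, hp, quad]
  ring

/-- With alternating signs x_c + x_{c+1} telescopes. The alternating sum of x vanishes by symmetry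
alone, because c ↦ 3 - c reverses the sign. -/
lemma quad_add_shift (hN : Even N) {x : ZMod N → ℂ} (hs : ∀ c, x (3 - c) = x c) (j : ZMod N) :
    quad (fun c => x c + x (c + 1)) j = sgn j * x j := by
  have hN0 : (N : ℂ) ≠ 0 := by exact_mod_cast NeZero.ne N
  have h0 : ∑ c, sgn c * x c = 0 := by
    have : ∑ c, sgn c * x c = -∑ c, sgn c * x c := by
      conv_lhs => rw [← Equiv.sum_comp (Equiv.subLeft (3 : ZMod N))]
      rw [← Finset.sum_neg_distrib]
      refine Finset.sum_congr rfl fun c _ => ?_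
      simp only [Equiv.subLeft_apply, hs, sgn_three_sub hN]
      ring
    linear_combination this / 2
  have s1 : ∑ c, sgn (c + 1) * (c - j).val * x c
      = ∑ c, sgn (c + 1 + 1) * (c - j + 1).val * x (c + 1) := by
    rw [← Equiv.sum_comp (Equiv.addRight (1 : ZMod N))]
    refine Finset.sum_congr rfl fun c _ => ?_
    simp only [Equiv.coe_addRight]
    congr 4; ring
  have h2 : ∀ c : ZMod N, c - j = -1 ↔ c = j - 1 := by
    intro c
    constructor <;> intro h
    · linear_combination h
    · linear_combination h
  have s2 : ∀ c : ZMod N, sgn (c + 1 + 1) * (c - j + 1).val * x (c + 1)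
      = -(sgn (c + 1) * (c - j).val * x (c + 1)) - sgn (c + 1) * x (c + 1)
        + if c = j - 1 then N * (sgn (c + 1) * x (c + 1)) else 0 := by
    intro c
    rw [sgn_add_one hN (c + 1), val_add_one_eq]
    simp only [h2]
    split_ifs <;> ring
  have h0' : ∑ c, sgn (c + 1) * x (c + 1) = 0 := by
    rw [← h0]
    exact Equiv.sum_comp (Equiv.addRight (1 : ZMod N)) (fun c => sgn c * x c)
  simp only [quad, mul_add, Finset.sum_add_distrib, s1]
  simp only [s2, Finset.sum_add_distrib, Finset.sum_sub_distrib, Finset.sum_neg_distrib, h0',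
    Finset.sum_ite_eq', Finset.mem_univ, if_true, sub_add_cancel]
  field_simp
  ring

lemma HasWirtingerAt.cyc {m w : ℂ} {f : ZMod N → ℂ → ℂ} {a b : ZMod N → ℂ}
    (hf : ∀ c, HasWirtingerAt (f c) (a c) (b c) w) (j : ZMod N) :
    HasWirtingerAt (fun w => cyc m (fun c => f c w) j) (cyc m a j) (cyc m b j) w :=
  (HasWirtingerAt.sum fun c _ => (hf c).const_mul _).const_mul _

lemma HasWirtingerAt.quad {w : ℂ} {f : ZMod N → ℂ → ℂ} {a b : ZMod N → ℂ}
    (hf : ∀ c, HasWirtingerAt (f c) (a c) (b c) w) (j : ZMod N) :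
    HasWirtingerAt (fun w => quad (fun c => f c w) j) (quad a j) (quad b j) w :=
  (HasWirtingerAt.sum fun c _ => (hf c).const_mul _).const_mul _

lemma quad_const_mul (k : ℂ) (f : ZMod N → ℂ) (j : ZMod N) :
    quad (fun c => k * f c) j = k * quad f j := by
  simp only [quad, Finset.mul_sum]
  exact Finset.sum_congr rfl fun c _ => by ring

end Cyclic

/-! ### The Lax pair on a cyclic chain of blocks, and the derivatives of γ_j and q_j. -/

section Chain

variable {N : ℕ} {ι : Type*} [Fintype ι]

/-- The sum of the entries of a column in block `j`. -/
noncomputable def blockSum (blk : ι → ZMod N) (f : ι → ℂ) (j : ZMod N) : ℂ :=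
  ∑ a with blk a = j, f a

lemma blockSum_eq_single {blk : ι → ZMod N} {j : ZMod N} {a : ι} (ha : ∀ b, blk b = j ↔ b = a)
    (f : ι → ℂ) : blockSum blk f j = f a := by
  classical
  have : (Finset.univ.filter fun b => blk b = j) = {a} := by ext b; simp [ha]
  rw [blockSum, this, Finset.sum_singleton]

lemma blockSum_eq_pair {blk : ι → ZMod N} {j : ZMod N} {a a' : ι} (hne : a ≠ a')
    (ha : ∀ b, blk b = j ↔ b = a ∨ b = a') (f : ι → ℂ) : blockSum blk f j = f a + f a' := by
  classical
  have : (Finset.univ.filter fun b => blk b = j) = {a, a'} := by ext b; simp [ha]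
  rw [blockSum, this, Finset.sum_pair hne]

/-- `h` is a column solution, with spectral parameter `μ`, of the Lax pair of a chain of blocks
indexed by `ZMod N`, for a diagonal matrix `v` with logarithmic derivative `p` which is inverted
by the reflection `σ` of the chain. -/
structure IsLaxChain (blk : ι → ZMod N) (σ : ι → ι) (v : ι → ℂ → ℝ) (p : ι → ℂ → ℂ)
    (h : ι → ℂ → ℂ) (μ : ℂ) (U : Set ℂ) : Prop where
  invol : ∀ a, σ (σ a) = a
  blk_invol : ∀ a, blk (σ a) = 2 - blk a
  -- The inverse of v_a is written `v (σ a)` throughout, which keeps the later identities free of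
  -- division by v.
  v_invol : ∀ a w, v a w * v (σ a) w = 1
  p_invol : ∀ a w, p (σ a) w = -p a w
  v_deriv : ∀ w ∈ U, ∀ a, HasWirtingerAt (fun w => (v a w : ℂ)) (p a w * v a w)
    (conj (p a w) * v a w) w
  h_deriv : ∀ w ∈ U, ∀ a, HasWirtingerAt (h a)
    (p a w * h a w + μ * blockSum blk (fun b => h b w) (blk a + 1))
    (μ⁻¹ * (v a w * blockSum blk (fun b => h b w * v (σ b) w) (blk a - 1))) w

namespace IsLaxChain

variable {blk : ι → ZMod N} {σ : ι → ι} {v : ι → ℂ → ℝ} {p : ι → ℂ → ℂ} {h : ι → ℂ → ℂ} {μ : ℂ}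
  {U : Set ℂ}

/-- The sum of `h_a` over the block `j`. -/
noncomputable def colSum (blk : ι → ZMod N) (h : ι → ℂ → ℂ) (j : ZMod N) (w : ℂ) : ℂ :=
  blockSum blk (fun b => h b w) j

/-- The sum of `h_a / v_a` over the block `j`. -/
noncomputable def dualSum (blk : ι → ZMod N) (σ : ι → ι) (v : ι → ℂ → ℝ) (h : ι → ℂ → ℂ)
    (j : ZMod N) (w : ℂ) : ℂ :=
  blockSum blk (fun b => h b w * v (σ b) w) j

/-- The sum of `|h_a|² / v_a` over the block `j`. -/
noncomputable def normSum (blk : ι → ZMod N) (σ : ι → ι) (v : ι → ℂ → ℝ) (h : ι → ℂ → ℂ)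
    (j : ZMod N) (w : ℂ) : ℂ :=
  blockSum blk (fun b => h b w * conj (h b w) * v (σ b) w) j

/-- The sum of `h_a h_{σ a}` over the block `j`. -/
noncomputable def pairSum (blk : ι → ZMod N) (σ : ι → ι) (h : ι → ℂ → ℂ)
    (j : ZMod N) (w : ℂ) : ℂ :=
  blockSum blk (fun b => h b w * h (σ b) w) j

lemma v_invol_ofReal (hc : IsLaxChain blk σ v p h μ U) (a : ι) (w : ℂ) :
    (v a w : ℂ) * v (σ a) w = 1 := by exact_mod_cast hc.v_invol a w

/-- The reflection `σ` identifies the blocks `j` and `2 - j`. -/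
lemma blockSum_invol (hc : IsLaxChain blk σ v p h μ U) (f : ι → ℂ) (j : ZMod N) :
    blockSum blk (fun a => f (σ a)) j = blockSum blk f (2 - j) := by
  refine Finset.sum_nbij' σ σ ?_ ?_ (fun a _ => hc.invol a) (fun a _ => hc.invol a)
    (fun a _ => rfl)
  · intro a ha
    simp only [Finset.mem_filter, Finset.mem_univ, true_and] at ha ⊢
    rw [hc.blk_invol, ha]
  · intro a ha
    simp only [Finset.mem_filter, Finset.mem_univ, true_and] at ha ⊢
    rw [hc.blk_invol, ha]; ring

/-- Division by v removes p from the z-derivative and puts its conjugate into the z̄-derivative. -/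
lemma dual_deriv (hc : IsLaxChain blk σ v p h μ U) {w : ℂ} (hw : w ∈ U) (a : ι) :
    HasWirtingerAt (fun w => h a w * v (σ a) w) (μ * (v (σ a) w * colSum blk h (blk a + 1) w))
      (μ⁻¹ * dualSum blk σ v h (blk a - 1) w - conj (p a w) * (h a w * v (σ a) w)) w := by
  refine ((hc.h_deriv w hw a).mul (hc.v_deriv w hw (σ a))).congr_deriv ?_ ?_
  · rw [hc.p_invol, colSum]; ring
  · rw [hc.p_invol, dualSum, map_neg]
    linear_combination (μ⁻¹ * blockSum blk (fun b => h b w * v (σ b) w) (blk a - 1))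
      * hc.v_invol_ofReal a w

lemma h_deriv_colSum (hc : IsLaxChain blk σ v p h μ U) {w : ℂ} (hw : w ∈ U) (a : ι) :
    HasWirtingerAt (h a) (p a w * h a w + μ * colSum blk h (blk a + 1) w)
      (μ⁻¹ * (v a w * dualSum blk σ v h (blk a - 1) w)) w :=
  hc.h_deriv w hw a

lemma conj_blockSum (f : ι → ℂ) (j : ZMod N) :
    conj (blockSum blk f j) = blockSum blk (fun a => conj (f a)) j := by
  simp [blockSum]

/-- The summand is the product of h_a / v_a and conj h_a. Neither factor has a p-term in its
z-derivative, and in the z̄-derivative the two p-terms cancel. -/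
lemma normSum_deriv (hc : IsLaxChain blk σ v p h μ U) {w : ℂ} (hw : w ∈ U) (j : ZMod N) :
    HasWirtingerAt (normSum blk σ v h j)
      (μ * (colSum blk h (j + 1) w * conj (dualSum blk σ v h j w))
        + (conj μ)⁻¹ * (colSum blk h j w * conj (dualSum blk σ v h (j - 1) w)))
      (μ⁻¹ * (conj (colSum blk h j w) * dualSum blk σ v h (j - 1) w)
        + conj μ * (conj (colSum blk h (j + 1) w) * dualSum blk σ v h j w)) w := by
  have key := HasWirtingerAt.sum (s := Finset.univ.filter fun a => blk a = j)
    fun a _ => (hc.dual_deriv hw a).mul (hc.h_deriv_colSum hw a).star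
  have e : normSum blk σ v h j
      = fun w => ∑ a with blk a = j, h a w * v (σ a) w * conj (h a w) := by
    ext w
    exact Finset.sum_congr rfl fun a _ => by ring
  rw [e]
  have v1 := fun a => hc.v_invol_ofReal a w
  refine key.congr_deriv ?_ ?_
  · conv_rhs => rw [dualSum, conj_blockSum, colSum.eq_def blk h j]
    simp only [blockSum, Finset.mul_sum, Finset.sum_mul, ← Finset.sum_add_distrib]
    refine Finset.sum_congr rfl fun a ha => ?_
    rw [(Finset.mem_filter.mp ha).2]
    simp only [map_mul, map_inv₀, Complex.conj_ofReal]
    linear_combination ((conj μ)⁻¹ * h a w * conj (dualSum blk σ v h (j - 1) w)) * v1 a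
  · conv_rhs => rw [dualSum.eq_def blk σ v h j, colSum.eq_def blk h j, conj_blockSum]
    simp only [blockSum, Finset.mul_sum, Finset.sum_mul, ← Finset.sum_add_distrib]
    refine Finset.sum_congr rfl fun a ha => ?_
    rw [(Finset.mem_filter.mp ha).2]
    simp only [map_mul, map_add]
    ring

/-- The p-terms cancel because σ negates p. Both derivatives are arranged as x_j + x_{j+1} with x
invariant under j ↦ 3 - j, the input of `quad_add_shift`. -/
lemma pairSum_deriv (hc : IsLaxChain blk σ v p h μ U) {w : ℂ} (hw : w ∈ U) (j : ZMod N) :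
    HasWirtingerAt (pairSum blk σ h j)
      (μ * (colSum blk h j w * colSum blk h (3 - j) w
        + colSum blk h (j + 1) w * colSum blk h (3 - (j + 1)) w))
      (μ⁻¹ * (dualSum blk σ v h (j - 1) w * dualSum blk σ v h (2 - j) w
        + dualSum blk σ v h (j + 1 - 1) w * dualSum blk σ v h (2 - (j + 1)) w)) w := by
  have key := HasWirtingerAt.sum (s := Finset.univ.filter fun a => blk a = j)
    fun a _ => (hc.h_deriv_colSum hw a).mul (hc.h_deriv_colSum hw (σ a))
  refine HasWirtingerAt.congr_deriv key ?_ ?_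
  · have e1 : 3 - (j + 1) = 2 - j := by ring
    have e2 : 2 - j + 1 = 3 - j := by ring
    conv_rhs => rw [e1, colSum.eq_def blk h j, colSum.eq_def blk h (2 - j), ← hc.blockSum_invol]
    simp only [blockSum, Finset.mul_sum, Finset.sum_mul, mul_add, ← Finset.sum_add_distrib]
    refine Finset.sum_congr rfl fun a ha => ?_
    rw [hc.blk_invol, (Finset.mem_filter.mp ha).2, hc.p_invol, e2]
    ring
  · have e1 : 2 - (j + 1) = 1 - j := by ring
    have e2 : 2 - j - 1 = 1 - j := by ring
    conv_rhs => rw [e1, add_sub_cancel_right, dualSum.eq_def blk σ v h j,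
      dualSum.eq_def blk σ v h (2 - j), ← hc.blockSum_invol]
    simp only [blockSum, Finset.mul_sum, Finset.sum_mul, mul_add, ← Finset.sum_add_distrib]
    refine Finset.sum_congr rfl fun a ha => ?_
    rw [hc.blk_invol, (Finset.mem_filter.mp ha).2, e2, hc.invol]
    ring

/-- Only the z̄-derivative closes up: the z-derivative weights the rows of the block by their
separate p_a. For `dualSum` the roles are exchanged. The unspecified derivatives are not needed
later. -/
lemma colSum_deriv (hc : IsLaxChain blk σ v p h μ U) {w : ℂ} (hw : w ∈ U) (j : ZMod N) :
    ∃ X, HasWirtingerAt (colSum blk h j) X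
      (μ⁻¹ * (blockSum blk (fun a => (v a w : ℂ)) j * dualSum blk σ v h (j - 1) w)) w := by
  refine ⟨_, HasWirtingerAt.congr_deriv
    (HasWirtingerAt.sum (s := Finset.univ.filter fun a => blk a = j)
    fun a _ => hc.h_deriv_colSum hw a) rfl ?_⟩
  simp only [blockSum, Finset.mul_sum, Finset.sum_mul]
  refine Finset.sum_congr rfl fun a ha => ?_
  rw [(Finset.mem_filter.mp ha).2]

lemma dualSum_deriv (hc : IsLaxChain blk σ v p h μ U) {w : ℂ} (hw : w ∈ U) (j : ZMod N) :
    ∃ X, HasWirtingerAt (dualSum blk σ v h j)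
      (μ * (blockSum blk (fun a => (v a w : ℂ)) (2 - j) * colSum blk h (j + 1) w)) X w := by
  refine ⟨_, HasWirtingerAt.congr_deriv
    (HasWirtingerAt.sum (s := Finset.univ.filter fun a => blk a = j)
    fun a _ => hc.dual_deriv hw a) ?_ rfl⟩
  rw [← hc.blockSum_invol (fun a => (v a w : ℂ))]
  simp only [blockSum, Finset.mul_sum, Finset.sum_mul]
  refine Finset.sum_congr rfl fun a ha => ?_
  rw [(Finset.mem_filter.mp ha).2]

lemma pairSum_two_sub (hc : IsLaxChain blk σ v p h μ U) (j : ZMod N) (w : ℂ) :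
    pairSum blk σ h (2 - j) w = pairSum blk σ h j w := by
  rw [pairSum, ← hc.blockSum_invol, pairSum]
  exact Finset.sum_congr rfl fun a _ => by simp only [hc.invol]; ring

variable [NeZero N]

/-- The functions `γ_j`. -/
noncomputable def gamma (blk : ι → ZMod N) (σ : ι → ι) (v : ι → ℂ → ℝ) (h : ι → ℂ → ℂ) (μ : ℂ)
    (j : ZMod N) (w : ℂ) : ℂ :=
  cyc (-(μ * conj μ)) (fun c => normSum blk σ v h c w) j

/-- The functions whose square norms are the first terms of the `g_j`. -/
noncomputable def quadSum (blk : ι → ZMod N) (σ : ι → ι) (h : ι → ℂ → ℂ)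
    (j : ZMod N) (w : ℂ) : ℂ :=
  quad (fun c => pairSum blk σ h c w) j

/-- The functions `g_j`. -/
noncomputable def gfun (blk : ι → ZMod N) (σ : ι → ι) (v : ι → ℂ → ℝ) (h : ι → ℂ → ℂ) (μ : ℂ)
    (j : ZMod N) (w : ℂ) : ℂ :=
  quadSum blk σ h j w * conj (quadSum blk σ h j w)
    - μ * conj μ * (gamma blk σ v h μ (j - 1) w * gamma blk σ v h μ (2 - j) w)

/-- The weight -|μ|² in γ_j is the one for which the derivative of n_c is a twisted difference, so
that `cyc_sub_shift` applies. -/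
lemma gamma_deriv (hc : IsLaxChain blk σ v p h μ U) {w : ℂ} (hw : w ∈ U) (hμ : μ ≠ 0)
    (hm : (-(μ * conj μ)) ^ N ≠ 1) (j : ZMod N) :
    HasWirtingerAt (gamma blk σ v h μ j)
      ((conj μ)⁻¹ * (colSum blk h (2 - j) w * conj (dualSum blk σ v h (1 - j) w)))
      (μ⁻¹ * (conj (colSum blk h (2 - j) w) * dualSum blk σ v h (1 - j) w)) w := by
  have hμ' : conj μ ≠ 0 := by simpa using hμ
  have hm0 : -(μ * conj μ) ≠ 0 := neg_ne_zero.mpr (mul_ne_zero hμ hμ')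
  have e2 : 1 - j + 1 = 2 - j := by ring
  refine HasWirtingerAt.congr_deriv (HasWirtingerAt.cyc (fun c => hc.normSum_deriv hw c) j) ?_ ?_
  · have := cyc_sub_shift hm0 hm
      (fun c => μ * (colSum blk h (c + 1) w * conj (dualSum blk σ v h c w))) j
    rw [e2] at this
    convert this using 2
    · ext c
      simp only [sub_add_cancel]
      field_simp
      ring
    · field_simp
  · have := cyc_sub_shift hm0 hm
      (fun c => conj μ * (conj (colSum blk h (c + 1) w) * dualSum blk σ v h c w)) j
    rw [e2] at this
    convert this using 2
    · ext c
      simp only [sub_add_cancel]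
      field_simp
      ring
    · field_simp

lemma quadSum_deriv (hc : IsLaxChain blk σ v p h μ U) {w : ℂ} (hw : w ∈ U) (hN : Even N)
    (j : ZMod N) :
    HasWirtingerAt (quadSum blk σ h j)
      (μ * (sgn j * (colSum blk h j w * colSum blk h (3 - j) w)))
      (μ⁻¹ * (sgn j * (dualSum blk σ v h (j - 1) w * dualSum blk σ v h (2 - j) w))) w := by
  refine HasWirtingerAt.congr_deriv (HasWirtingerAt.quad (fun c => hc.pairSum_deriv hw c) j) ?_ ?_
  · rw [quad_const_mul,
      quad_add_shift hN (x := fun c => colSum blk h c w * colSum blk h (3 - c) w)]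
    intro c
    rw [sub_sub_cancel]; ring
  · rw [quad_const_mul, quad_add_shift hN
      (x := fun c => dualSum blk σ v h (c - 1) w * dualSum blk σ v h (2 - c) w)]
    intro c
    have e1 : 3 - c - 1 = 2 - c := by ring
    have e2 : 2 - (3 - c) = c - 1 := by ring
    rw [e1, e2]; ring

end IsLaxChain

end Chain

/-! ### Recurrences and reflection symmetry of γ_j, q_j and g_j. -/

namespace IsLaxChain

variable {N : ℕ} {ι : Type*} [Fintype ι] {blk : ι → ZMod N} {σ : ι → ι}
  {v : ι → ℂ → ℝ} {p : ι → ℂ → ℂ} {h : ι → ℂ → ℂ} {μ : ℂ} {U : Set ℂ}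

lemma single_invol (hc : IsLaxChain blk σ v p h μ U) {j : ZMod N} {a : ι}
    (ha : ∀ b, blk b = j ↔ b = a) (b : ι) : blk b = 2 - j ↔ b = σ a := by
  have h1 := ha (σ b)
  rw [hc.blk_invol] at h1
  have h2 : 2 - blk b = j ↔ blk b = 2 - j := by
    constructor <;> intro h
    · linear_combination -h
    · linear_combination -h
  rw [← h2, h1]
  constructor <;> intro h
  · rw [← h, hc.invol]
  · rw [h, hc.invol]

lemma conj_normSum (j : ZMod N) (w : ℂ) :
    conj (normSum blk σ v h j w) = normSum blk σ v h j w := by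
  rw [normSum, conj_blockSum]
  refine congrArg (blockSum blk · j) (funext fun a => ?_)
  simp only [map_mul, Complex.conj_conj, Complex.conj_ofReal]
  ring

variable [NeZero N]

lemma conj_gamma (j : ZMod N) (w : ℂ) :
    conj (gamma blk σ v h μ j w) = gamma blk σ v h μ j w := by
  simp only [gamma, cyc, map_mul, map_sum, conj_normSum, map_pow, map_neg, map_div₀, map_sub,
    map_one, Complex.conj_conj, mul_comm (conj μ) μ]

lemma gamma_add_one (hm : (-(μ * conj μ)) ^ N ≠ 1) (j : ZMod N) (w : ℂ) :
    gamma blk σ v h μ (j + 1) w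
      = -(μ * conj μ) * gamma blk σ v h μ j w + normSum blk σ v h (1 - j) w :=
  cyc_add_one hm _ j

lemma quadSum_add_one (hN : Even N) {w : ℂ} (hq : ∑ c, sgn c * pairSum blk σ h c w = 0)
    (j : ZMod N) :
    quadSum blk σ h (j + 1) w = quadSum blk σ h j w - sgn j * pairSum blk σ h j w :=
  quad_add_one hN hq j

lemma quadSum_three_sub (hc : IsLaxChain blk σ v p h μ U) (hN : Even N) {w : ℂ}
    (hq : ∑ c, sgn c * pairSum blk σ h c w = 0) (j : ZMod N) :
    quadSum blk σ h (3 - j) w = -quadSum blk σ h j w :=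
  quad_three_sub hN hq (fun c => hc.pairSum_two_sub c w) j

/-- The reflection changes the sign of q_j and swaps the two γ-factors. -/
lemma gfun_three_sub (hc : IsLaxChain blk σ v p h μ U) (hN : Even N) {w : ℂ}
    (hq : ∑ c, sgn c * pairSum blk σ h c w = 0) (j : ZMod N) :
    gfun blk σ v h μ (3 - j) w = gfun blk σ v h μ j w := by
  have e1 : 3 - j - 1 = 2 - j := by ring
  have e2 : 2 - (3 - j) = j - 1 := by ring
  rw [gfun, gfun, hc.quadSum_three_sub hN hq, e1, e2, map_neg]
  ring

/-- The step from `g_j` to `g_{j+1}` across a block of size one. -/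
lemma gfun_add_one (hc : IsLaxChain blk σ v p h μ U) (hN : Even N)
    (hm : (-(μ * conj μ)) ^ N ≠ 1) {w : ℂ} (hq : ∑ c, sgn c * pairSum blk σ h c w = 0)
    {j : ZMod N} {a : ι} (ha : ∀ b, blk b = j ↔ b = a) :
    v a w * gfun blk σ v h μ (j + 1) w = v a w * gfun blk σ v h μ j w
      - sgn j * (quadSum blk σ h j w * conj (colSum blk h j w) * conj (dualSum blk σ v h (2 - j) w)
        + conj (quadSum blk σ h j w) * colSum blk h j w * dualSum blk σ v h (2 - j) w)
      + μ * conj μ * gamma blk σ v h μ (j - 1) w * colSum blk h j w * conj (colSum blk h j w)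
      + gamma blk σ v h μ (2 - j) w * dualSum blk σ v h (2 - j) w
        * conj (dualSum blk σ v h (2 - j) w) := by
  have ha' := hc.single_invol ha
  have e1 : j + 1 - 1 = j - 1 + 1 := by ring
  have e2 : 2 - (j + 1) = 1 - j := by ring
  have e3 : 2 - j = 1 - j + 1 := by ring
  have e4 : 1 - (j - 1) = 2 - j := by ring
  have e5 : 1 - (1 - j) = j := by ring
  have hv := hc.v_invol_ofReal a w
  -- The two recurrences express γ_j and γ_{2-j} by γ_{j-1} and γ_{1-j}. The quartic term |p_j|² of
  -- |q_{j+1}|² is absorbed when the result is rewritten with γ_{2-j}.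
  have g1 := gamma_add_one (blk := blk) (σ := σ) (v := v) (h := h) hm (j - 1) w
  have g2 := gamma_add_one (blk := blk) (σ := σ) (v := v) (h := h) hm (1 - j) w
  rw [e4, normSum, blockSum_eq_single ha', hc.invol] at g1
  rw [e5, ← e3, normSum, blockSum_eq_single ha] at g2
  rw [gfun, gfun, quadSum_add_one hN hq, e1, e2, g1, g2, pairSum, blockSum_eq_single ha, colSum,
    blockSum_eq_single ha, dualSum, blockSum_eq_single ha', hc.invol, map_sub, map_mul, conj_sgn]
  simp only [map_mul, Complex.conj_ofReal]
  have hs := sgn_mul_self j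
  generalize sgn j = ε at *
  generalize h a w = x at *
  generalize h (σ a) w = y at *
  generalize (v a w : ℂ) = V at *
  generalize (v (σ a) w : ℂ) = V' at *
  generalize gamma blk σ v h μ (1 - j) w = C at *
  generalize gamma blk σ v h μ (j - 1) w = A at *
  generalize quadSum blk σ h j w = q at *
  linear_combination (V * x * y * conj x * conj y) * hs
    + (μ * conj μ * A * x * conj x - V * y * conj y * x * conj x) * hv

end IsLaxChain

/-! ### Second derivatives of g_j and Hirota's equation. -/

namespace IsLaxChain

variable {N : ℕ} [NeZero N] {ι : Type*} [Fintype ι] {blk : ι → ZMod N} {σ : ι → ι}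
  {v : ι → ℂ → ℝ} {p : ι → ℂ → ℂ} {h : ι → ℂ → ℂ} {μ : ℂ} {U : Set ℂ}

/-- The derivative `∂_z g_j`. -/
noncomputable def gderiv (blk : ι → ZMod N) (σ : ι → ι) (v : ι → ℂ → ℝ) (h : ι → ℂ → ℂ) (μ : ℂ)
    (j : ZMod N) (w : ℂ) : ℂ :=
  μ * sgn j * (colSum blk h j w * colSum blk h (3 - j) w * conj (quadSum blk σ h j w))
    + (conj μ)⁻¹ * sgn j * (conj (dualSum blk σ v h (j - 1) w)
      * conj (dualSum blk σ v h (2 - j) w) * quadSum blk σ h j w)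
    - μ * (colSum blk h (3 - j) w * conj (dualSum blk σ v h (2 - j) w)
        * gamma blk σ v h μ (2 - j) w
      + colSum blk h j w * conj (dualSum blk σ v h (j - 1) w) * gamma blk σ v h μ (j - 1) w)

lemma gfun_deriv (hc : IsLaxChain blk σ v p h μ U) {w : ℂ} (hw : w ∈ U) (hμ : μ ≠ 0)
    (hN : Even N) (hm : (-(μ * conj μ)) ^ N ≠ 1) (j : ZMod N) :
    HasWirtingerAt (gfun blk σ v h μ j) (gderiv blk σ v h μ j w)
      (conj (gderiv blk σ v h μ j w)) w := by
  have hμ' : conj μ ≠ 0 := by simpa using hμ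
  have e1 : 2 - (j - 1) = 3 - j := by ring
  have e2 : 1 - (j - 1) = 2 - j := by ring
  have e3 : 2 - (2 - j) = j := by ring
  have e4 : 1 - (2 - j) = j - 1 := by ring
  have hq := hc.quadSum_deriv hw hN j
  have hA := hc.gamma_deriv hw hμ hm (j - 1)
  have hB := hc.gamma_deriv hw hμ hm (2 - j)
  rw [e1, e2] at hA
  rw [e3, e4] at hB
  refine HasWirtingerAt.congr_deriv ((hq.mul hq.star).sub ((hA.mul hB).const_mul (μ * conj μ)))
    ?_ ?_
  · simp only [gderiv, map_mul, map_inv₀, conj_sgn]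
    field_simp
  · simp only [gderiv, map_mul, map_inv₀, conj_sgn, map_add, map_sub, Complex.conj_conj,
      conj_gamma]
    field_simp
    ring

/-- Apart from q_j, γ_j and their conjugates, `gderiv` contains only column sums and conjugates of
dual sums, whose z̄-derivatives close up. Hence the mixed second derivative is explicit while ∂_z²
stays unspecified. -/
lemma gderiv_deriv (hc : IsLaxChain blk σ v p h μ U) {w : ℂ} (hw : w ∈ U) (hμ : μ ≠ 0)
    (hN : Even N) (hm : (-(μ * conj μ)) ^ N ≠ 1) (j : ZMod N) {ν ν' X Y x y q A B : ℂ}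
    (hν : ν = blockSum blk (fun a => (v a w : ℂ)) j)
    (hν' : ν' = blockSum blk (fun a => (v a w : ℂ)) (3 - j))
    (hX : X = colSum blk h j w) (hY : Y = colSum blk h (3 - j) w)
    (hx : x = dualSum blk σ v h (j - 1) w) (hy : y = dualSum blk σ v h (2 - j) w)
    (hq : q = quadSum blk σ h j w) (hA : A = gamma blk σ v h μ (j - 1) w)
    (hB : B = gamma blk σ v h μ (2 - j) w) :
    ∃ Z, HasWirtingerAt (gderiv blk σ v h μ j) Z
      (sgn j * (ν * x * Y * conj q + ν' * X * y * conj q + ν' * conj X * conj y * q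
          + ν * conj x * conj Y * q)
        + μ * conj μ * (X * conj X * Y * conj Y) + (μ * conj μ)⁻¹ * (x * conj x * y * conj y)
        - (ν' * y * conj y * B + μ * conj μ * ν * Y * conj Y * B + Y * conj y * conj X * x
          + ν * x * conj x * A + μ * conj μ * ν' * X * conj X * A
          + X * conj x * conj Y * y)) w := by
  have hμ' : conj μ ≠ 0 := by simpa using hμ
  have e1 : 2 - (j - 1) = 3 - j := by ring
  have e2 : 1 - (j - 1) = 2 - j := by ring
  have e3 : 2 - (2 - j) = j := by ring
  have e4 : 1 - (2 - j) = j - 1 := by ring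
  have e5 : 3 - j - 1 = 2 - j := by ring
  have e6 : 2 - j + 1 = 3 - j := by ring
  have dq := hc.quadSum_deriv hw hN j
  have dA := hc.gamma_deriv hw hμ hm (j - 1)
  have dB := hc.gamma_deriv hw hμ hm (2 - j)
  obtain ⟨_, dX⟩ := hc.colSum_deriv hw j
  obtain ⟨_, dY⟩ := hc.colSum_deriv hw (3 - j)
  obtain ⟨_, dx⟩ := hc.dualSum_deriv hw (j - 1)
  obtain ⟨_, dy⟩ := hc.dualSum_deriv hw (2 - j)
  rw [e1, e2] at dA
  rw [e3, e4] at dB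
  rw [e5] at dY
  rw [e1, sub_add_cancel] at dx
  rw [e3, e6] at dy
  have hs := sgn_mul_self j
  refine ⟨_, HasWirtingerAt.congr_deriv (((((dX.mul dY).mul dq.star).const_mul (μ * sgn j)).add
    (((dx.star.mul dy.star).mul dq).const_mul ((conj μ)⁻¹ * sgn j))).sub
    ((((dY.mul dy.star).mul dB).add ((dX.mul dx.star).mul dA)).const_mul μ)) rfl ?_⟩
  have hn : conj ν = ν := by rw [hν, conj_blockSum]; simp
  have hn' : conj ν' = ν' := by rw [hν', conj_blockSum]; simp
  simp only [map_mul, conj_sgn, ← hν, ← hν', hn, hn', ← hX, ← hY, ← hx, ← hy, ← hq,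
    ← hA, ← hB, mul_inv]
  clear hn hn' hX hY hx hy hq hA hB hν hν' dq dA dB dX dY dx dy
  have i1 : μ * μ⁻¹ = 1 := mul_inv_cancel₀ hμ
  have i2 : conj μ * (conj μ)⁻¹ = 1 := mul_inv_cancel₀ hμ'
  -- Inverses and conjugates become independent letters; the claim is then a polynomial identity
  -- modulo ε² = 1, μ μi = 1 and μ' μj = 1.
  generalize μ⁻¹ = μi at *
  generalize (conj μ)⁻¹ = μj at *
  generalize conj μ = μ' at *
  generalize sgn j = ε at *
  linear_combination (μ * μ' * (X * conj X * Y * conj Y) + μi * μj * (x * conj x * y * conj y)) * hs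
    + (ε * (ν * x * Y * conj q + ν' * X * y * conj q) - (ν' * y * conj y * B
      + Y * conj y * conj X * x + ν * x * conj x * A + X * conj x * conj Y * y)) * i1
    + (ε * (ν' * conj X * conj y * q + ν * conj x * conj Y * q)) * i2

/-- Hirota's bilinear equation for `log g_j` between two blocks of size one. -/
lemma laplacian_log_gfun (hc : IsLaxChain blk σ v p h μ U) (hU : IsOpen U) {w : ℂ} (hw : w ∈ U)
    (hμ : μ ≠ 0) (hN : Even N) (hm : (-(μ * conj μ)) ^ N ≠ 1)
    (hq : ∑ c, sgn c * pairSum blk σ h c w = 0) {j : ZMod N} {a b : ι}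
    (ha : ∀ c, blk c = j ↔ c = a) (hb : ∀ c, blk c = j - 1 ↔ c = b) {G : ℂ → ℝ} {r r' : ℝ}
    (hG : ∀ w ∈ U, (G w : ℂ) = gfun blk σ v h μ j w) (h0 : G w ≠ 0)
    (hr : (r : ℂ) = gfun blk σ v h μ (j + 1) w) (hr' : (r' : ℂ) = gfun blk σ v h μ (j - 1) w) :
    Δ (fun w => Real.log (G w)) w = v a w * v (σ b) w * (1 - r * r' / G w ^ 2) := by
  have hμ' : conj μ ≠ 0 := by simpa using hμ
  have hev : ∀ᶠ w' in nhds w, HasWirtingerAt (fun w => (G w : ℂ)) (gderiv blk σ v h μ j w')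
      (conj (gderiv blk σ v h μ j w')) w' := by
    filter_upwards [hU.mem_nhds hw] with w' hw'
    refine HasFDerivAt.congr_of_eventuallyEq (hc.gfun_deriv hw' hμ hN hm j) ?_
    filter_upwards [hU.mem_nhds hw'] with w'' hw''
    exact hG w'' hw''
  have hb' : ∀ c, blk c = 3 - j ↔ c = σ b := by
    have := hc.single_invol hb
    have e : 2 - (j - 1) = 3 - j := by ring
    rwa [e] at this
  obtain ⟨Z, hZ⟩ := hc.gderiv_deriv hw hμ hN hm j rfl rfl rfl rfl rfl rfl rfl rfl rfl
  refine laplacian_log_eq hev hZ h0 ?_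
  have g1 := hc.gfun_add_one hN hm hq ha
  -- Across the mirror block 3 - j the same step leads from g_j down to g_{j-1}, by the symmetry
  -- g_{3-k} = g_k.
  have g2 := hc.gfun_add_one hN hm hq hb'
  have e1 : (3 : ZMod N) - j + 1 = 3 - (j - 1) := by ring
  have e2 : (2 : ZMod N) - (3 - j) = j - 1 := by ring
  have e3 : (3 : ZMod N) - j - 1 = 2 - j := by ring
  rw [e1, e2, e3, hc.gfun_three_sub hN hq, hc.gfun_three_sub hN hq, hc.quadSum_three_sub hN hq,
    sgn_three_sub hN, ← hr', ← hG w hw, map_neg] at g2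
  rw [← hr, ← hG w hw] at g1
  rw [blockSum_eq_single ha, blockSum_eq_single hb']
  have h3 : (G w : ℂ) = _ := hG w hw
  rw [gfun] at h3
  simp only [gderiv, map_mul, map_inv₀, conj_sgn, map_add, map_sub, Complex.conj_conj,
      conj_gamma, Complex.ofReal_mul]
  have hs := sgn_mul_self j
  generalize colSum blk h j w = X at *
  generalize colSum blk h (3 - j) w = Y at *
  generalize dualSum blk σ v h (j - 1) w = x at *
  generalize dualSum blk σ v h (2 - j) w = y at *
  generalize quadSum blk σ h j w = q at *
  generalize gamma blk σ v h μ (j - 1) w = A at *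
  generalize gamma blk σ v h μ (2 - j) w = B at *
  generalize (G w : ℂ) = g at *
  generalize (v a w : ℂ) = ν at *
  generalize (v (σ b) w : ℂ) = ν' at *
  generalize conj X = X' at *
  generalize conj Y = Y' at *
  generalize conj x = x' at *
  generalize conj y = y' at *
  generalize conj q = q' at *
  generalize sgn j = ε at *
  have i1 : μ * μ⁻¹ = 1 := mul_inv_cancel₀ hμ
  have i2 : conj μ * (conj μ)⁻¹ = 1 := mul_inv_cancel₀ hμ'
  rw [mul_inv]
  generalize μ⁻¹ = μi at *
  generalize (conj μ)⁻¹ = μj at *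
  generalize conj μ = μ' at *
  subst h3
  -- The two steps read ν r = ν g + R₁ and ν' r' = ν' g + R₂. Their product gives ν ν' (g² - r r') =
  -- -g (ν R₂ + ν' R₁) - R₁ R₂, which is matched with the derivatives of g.
  set R₁ := -ε * (q * X' * y' + q' * X * y) + μ * μ' * A * X * X' + B * y * y' with hR₁
  set R₂ := -ε * (q * Y' * x' + q' * Y * x) + μ * μ' * B * Y * Y' + A * x * x' with hR₂
  linear_combination (ν' * r') * g1 + (ν * (q * q' - μ * μ' * (A * B)) + R₁) * g2
    + ((q * X' * y' + q' * X * y) * (q * Y' * x' + q' * Y * x)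
      - (μ * μ' * X * Y * X' * Y' * q * q' + μ * μi * X * Y * x * y * q' ^ 2
        + μj * μ' * x' * y' * X' * Y' * q ^ 2 + μj * μi * x * y * x' * y' * q * q')) * hs
    + (-X * Y * x * y * q' ^ 2 + (Y * y' * B + X * x' * A) * ε * x * y * q'
      - A * B * x * y * x' * y' * (μ' * μj)) * i1
    + (-x' * y' * X' * Y' * q ^ 2 + ε * x' * y' * q * (Y' * y * B + X' * x * A)
      - A * B * x * y * x' * y') * i2

end IsLaxChain

/-! ### Blocks of size two. -/

namespace IsLaxChain

variable {N : ℕ} [NeZero N] {ι : Type*} [Fintype ι] {blk : ι → ZMod N} {σ : ι → ι}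
  {v : ι → ℂ → ℝ} {p : ι → ℂ → ℂ} {h : ι → ℂ → ℂ} {μ : ℂ} {U : Set ℂ}

/-- At a block of size two, `g` factors. -/
lemma gfun_pair (hc : IsLaxChain blk σ v p h μ U) (hN : Even N)
    (hm : (-(μ * conj μ)) ^ N ≠ 1) {w : ℂ} (hq : ∑ c, sgn c * pairSum blk σ h c w = 0)
    {c : ZMod N} (hcc : 2 - c = c) {a : ι} (hne : a ≠ σ a)
    (ha : ∀ b, blk b = c ↔ b = a ∨ b = σ a) :
    sgn (c + 1) * quadSum blk σ h (c + 1) w = h a w * h (σ a) w ∧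
    -(μ * conj μ) * gamma blk σ v h μ (c - 1) w = gamma blk σ v h μ c w
        - h a w * conj (h a w) * v (σ a) w - h (σ a) w * conj (h (σ a) w) * v a w ∧
    gfun blk σ v h μ (c + 1) w = (h a w * conj (h a w) * v (σ a) w - gamma blk σ v h μ c w)
      * (h (σ a) w * conj (h (σ a) w) * v a w - gamma blk σ v h μ c w) := by
  have e1 : 3 - (c + 1) = c := by linear_combination hcc
  have e2 : 1 - (c - 1) = c := by linear_combination hcc
  have e3 : 2 - (c + 1) = c - 1 := by linear_combination hcc
  have e4 : c + 1 - 1 = c := by ring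
  -- At a fixed block q_c = q_{3-(c+1)} = -q_{c+1}, so the recurrence determines q_{c+1} from p_c,
  -- in which the product of the two rows occurs twice.
  have q1 := quadSum_add_one (blk := blk) (σ := σ) (h := h) hN hq c
  have q2 := hc.quadSum_three_sub hN hq (c + 1)
  have q3 := gamma_add_one (blk := blk) (σ := σ) (v := v) (h := h) hm (c - 1) w
  rw [e1] at q2
  rw [q2, pairSum, blockSum_eq_pair hne ha, hc.invol] at q1
  rw [sub_add_cancel, e2, normSum, blockSum_eq_pair hne ha, hc.invol] at q3
  have hs := sgn_mul_self c
  have hv := hc.v_invol_ofReal a w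
  have r1 : sgn (c + 1) * quadSum blk σ h (c + 1) w = h a w * h (σ a) w := by
    rw [sgn_add_one hN]
    linear_combination (-sgn c / 2) * q1 + (h a w * h (σ a) w) * hs
  have r2 : -(μ * conj μ) * gamma blk σ v h μ (c - 1) w = gamma blk σ v h μ c w
      - h a w * conj (h a w) * v (σ a) w - h (σ a) w * conj (h (σ a) w) * v a w := by
    linear_combination -q3
  refine ⟨r1, r2, ?_⟩
  have r3 := congrArg conj r1
  rw [map_mul, map_mul, conj_sgn] at r3
  rw [gfun, e3, e4]
  have hs' := sgn_mul_self (c + 1)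
  linear_combination (sgn (c + 1) * conj (quadSum blk σ h (c + 1) w)) * r1
    + (h a w * h (σ a) w) * r3 + gamma blk σ v h μ c w * r2
    - (quadSum blk σ h (c + 1) w * conj (quadSum blk σ h (c + 1) w)) * hs'
    - (h a w * conj (h a w) * h (σ a) w * conj (h (σ a) w)) * hv

/-- The derivative `∂_z (|h_a|² / v_a - γ_c)` for a row `a` of a block `c` of size two. -/
noncomputable def pairDeriv (blk : ι → ZMod N) (σ : ι → ι) (v : ι → ℂ → ℝ) (h : ι → ℂ → ℂ) (μ : ℂ)
    (c : ZMod N) (a : ι) (w : ℂ) : ℂ :=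
  μ * (colSum blk h (c + 1) w * conj (h a w * v (σ a) w))
    - (conj μ)⁻¹ * (h (σ a) w * conj (dualSum blk σ v h (c - 1) w))

/-- The z-derivative of γ_c contains the column sum over both rows; the part of row a cancels
against the derivative of |h_a|²/v_a, and only the other row remains. -/
lemma pair_deriv (hc : IsLaxChain blk σ v p h μ U) {w : ℂ} (hw : w ∈ U) (hμ : μ ≠ 0)
    (hm : (-(μ * conj μ)) ^ N ≠ 1)
    {c : ZMod N} (hcc : 2 - c = c) {a : ι} (hne : a ≠ σ a)
    (ha : ∀ b, blk b = c ↔ b = a ∨ b = σ a) :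
    HasWirtingerAt (fun w => h a w * conj (h a w) * v (σ a) w - gamma blk σ v h μ c w)
      (pairDeriv blk σ v h μ c a w) (conj (pairDeriv blk σ v h μ c a w)) w := by
  have e1 : 1 - c = c - 1 := by linear_combination hcc
  have hac : blk a = c := (ha a).mpr (Or.inl rfl)
  have d1 := hc.dual_deriv hw a
  have d2 := hc.h_deriv_colSum hw a
  have d3 := hc.gamma_deriv hw hμ hm c
  have hv := hc.v_invol_ofReal a w
  rw [hac] at d1 d2
  rw [hcc, e1, colSum.eq_def blk h c, blockSum_eq_pair hne ha] at d3
  have key := (d1.mul d2.star).sub d3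
  have e : (fun w => h a w * conj (h a w) * v (σ a) w - gamma blk σ v h μ c w)
      = fun w => h a w * v (σ a) w * conj (h a w) - gamma blk σ v h μ c w := by
    ext w; ring
  rw [e]
  refine key.congr_deriv ?_ ?_
  · simp only [pairDeriv, map_mul, map_inv₀, Complex.conj_ofReal]
    linear_combination ((conj μ)⁻¹ * h a w * conj (dualSum blk σ v h (c - 1) w)) * hv
  · simp only [pairDeriv, map_mul, map_add, map_sub, map_inv₀, Complex.conj_ofReal,
      Complex.conj_conj]
    ring

omit [NeZero N] in
lemma pairDeriv_deriv (hc : IsLaxChain blk σ v p h μ U) {w : ℂ} (hw : w ∈ U) (hμ : μ ≠ 0)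
    {c : ZMod N} (hcc : 2 - c = c) {a : ι} (hne : a ≠ σ a)
    (ha : ∀ b, blk b = c ↔ b = a ∨ b = σ a) {ν x x' V V' s t : ℂ}
    (hν : ν = blockSum blk (fun a => (v a w : ℂ)) (c + 1)) (hx : x = h a w) (hx' : x' = h (σ a) w)
    (hV : V = v a w) (hV' : V' = v (σ a) w)
    (hs : s = colSum blk h (c + 1) w) (ht : t = dualSum blk σ v h (c - 1) w) :
    ∃ Z, HasWirtingerAt (pairDeriv blk σ v h μ c a) Z
      (ν * (x * conj x * V' ^ 2 - x' * conj x') + μ * conj μ * V' * (s * conj s)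
        - (μ * conj μ)⁻¹ * V' * (t * conj t)) w := by
  have hμ' : conj μ ≠ 0 := by simpa using hμ
  have hac : blk a = c := (ha a).mpr (Or.inl rfl)
  have hac' : blk (σ a) = c := (ha _).mpr (Or.inr rfl)
  have e1 : 2 - (c - 1) = c + 1 := by linear_combination hcc
  have d1 := hc.dual_deriv hw a
  have d2 := hc.h_deriv_colSum hw (σ a)
  obtain ⟨_, d3⟩ := hc.colSum_deriv hw (c + 1)
  obtain ⟨_, d4⟩ := hc.dualSum_deriv hw (c - 1)
  rw [hac] at d1
  rw [hac'] at d2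
  rw [e1, sub_add_cancel, colSum.eq_def blk h c, blockSum_eq_pair hne ha] at d4
  rw [add_sub_cancel_right, dualSum.eq_def blk σ v h c, blockSum_eq_pair hne ha, hc.invol] at d3
  refine ⟨_, HasWirtingerAt.congr_deriv (((d3.mul d1.star).const_mul μ).sub
    ((d2.mul d4.star).const_mul (conj μ)⁻¹)) rfl ?_⟩
  have hn : conj ν = ν := by rw [hν, conj_blockSum]; simp
  have hn' : conj V' = V' := by rw [hV', Complex.conj_ofReal]
  have hv := hc.v_invol_ofReal a w
  rw [← hV, ← hV'] at hv
  simp only [map_mul, map_add, ← hν, hn, ← hx, ← hx', ← hV, ← hV', hn', ← hs,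
    ← ht, mul_inv]
  have i1 : μ * μ⁻¹ = 1 := mul_inv_cancel₀ hμ
  have i2 : conj μ * (conj μ)⁻¹ = 1 := mul_inv_cancel₀ hμ'
  generalize μ⁻¹ = μi at *
  generalize (conj μ)⁻¹ = μj at *
  generalize conj μ = μ' at *
  linear_combination (ν * (x * V' + x' * V) * conj x * V') * i1
    - (ν * x' * (conj x + conj x')) * i2 + (ν * x' * conj x) * hv

/-- The analogue of Hirota's equation at a block of size two. -/
lemma laplacian_log_pair (hc : IsLaxChain blk σ v p h μ U) (hU : IsOpen U) {w : ℂ} (hw : w ∈ U)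
    (hμ : μ ≠ 0) (hN : Even N) (hm : (-(μ * conj μ)) ^ N ≠ 1)
    (hq : ∑ c, sgn c * pairSum blk σ h c w = 0) {c : ZMod N} (hcc : 2 - c = c) {a b : ι}
    (hne : a ≠ σ a) (ha : ∀ b, blk b = c ↔ b = a ∨ b = σ a) (hb : ∀ d, blk d = c + 1 ↔ d = b)
    {G : ℂ → ℝ} {r : ℝ}
    (hG : ∀ w ∈ U, (G w : ℂ) = h a w * conj (h a w) * v (σ a) w - gamma blk σ v h μ c w)
    (h0 : G w ≠ 0) (hr : (r : ℂ) = gfun blk σ v h μ (c + 2) w) :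
    Δ (fun w => Real.log (G w)) w = v b w * v (σ a) w * (1 - r / G w ^ 2) := by
  have hμ' : conj μ ≠ 0 := by simpa using hμ
  have hev : ∀ᶠ w' in nhds w, HasWirtingerAt (fun w => (G w : ℂ)) (pairDeriv blk σ v h μ c a w')
      (conj (pairDeriv blk σ v h μ c a w')) w' := by
    filter_upwards [hU.mem_nhds hw] with w' hw'
    refine HasFDerivAt.congr_of_eventuallyEq (hc.pair_deriv hw' hμ hm hcc hne ha) ?_
    filter_upwards [hU.mem_nhds hw'] with w'' hw''
    exact hG w'' hw''
  obtain ⟨Z, hZ⟩ := hc.pairDeriv_deriv hw hμ hcc hne ha rfl rfl rfl rfl rfl rfl rfl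
  refine laplacian_log_eq hev hZ h0 ?_
  obtain ⟨q1, q2, q3⟩ := hc.gfun_pair hN hm hq hcc hne ha
  -- The step from g_{c+1} to g_{c+2} crosses a block of size one; with g_{c+1} replaced by its two
  -- factors it supplies the term r of the equation.
  have g1 := hc.gfun_add_one hN hm hq hb
  have e1 : c + 1 + 1 = c + 2 := by ring
  have e2 : 2 - (c + 1) = c - 1 := by linear_combination hcc
  have q1' := congrArg conj q1
  rw [e1, e2, add_sub_cancel_right, ← hr, q3] at g1
  rw [blockSum_eq_single hb]
  have h3 : (G w : ℂ) = _ := hG w hw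
  have hv := hc.v_invol_ofReal a w
  simp only [pairDeriv, map_mul, map_inv₀, conj_sgn, map_sub, Complex.conj_conj,
      Complex.ofReal_mul, Complex.conj_ofReal] at q1' ⊢
  generalize colSum blk h (c + 1) w = s at *
  generalize dualSum blk σ v h (c - 1) w = t at *
  generalize quadSum blk σ h (c + 1) w = q at *
  generalize gamma blk σ v h μ c w = A at *
  generalize gamma blk σ v h μ (c - 1) w = B at *
  generalize (G w : ℂ) = g at *
  generalize (v a w : ℂ) = V at *
  generalize (v (σ a) w : ℂ) = V' at *
  generalize (v b w : ℂ) = ν at *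
  generalize h a w = x at *
  generalize h (σ a) w = y at *
  generalize conj x = x' at *
  generalize conj y = y' at *
  generalize conj s = s' at *
  generalize conj t = t' at *
  generalize conj q = q' at *
  generalize sgn (c + 1) = ε at *
  have i1 : μ * μ⁻¹ = 1 := mul_inv_cancel₀ hμ
  have i2 : conj μ * (conj μ)⁻¹ = 1 := mul_inv_cancel₀ hμ'
  rw [mul_inv]
  generalize μ⁻¹ = μi at *
  generalize (conj μ)⁻¹ = μj at *
  generalize conj μ = μ' at *
  subst h3
  linear_combination V' * g1 - V' * s' * t' * q1 - V' * s * t * q1'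
    - μi * μj * V' * t * t' * q2 - B * V' * t * t' * (μ' * μj * i1 + i2)
    + (s * x' * V' * y' * t) * i1 + (s' * x * V' * y * t') * i2
    + (x * x' * V' * ν * y * y' - A * ν * y * y' + y * y' * μi * μj * t * t') * hv


end IsLaxChain

/-! ### Indices modulo 2l - 2 and the reflection of the rows. -/

section Index

variable (l : ℕ)

/-- The involution of the rows which exchanges the blocks `j` and `2 - j` and the two rows of the
blocks `1` and `l`. -/
def reflect : LaxIdx l → LaxIdx l
  | Sum.inl j =>
      if j = 1 then Sum.inr 0 else if j = (l : ZMod (2 * l - 2)) then Sum.inr 1 else Sum.inl (2 - j)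
  | Sum.inr 0 => Sum.inl 1
  | Sum.inr 1 => Sum.inl (l : ZMod (2 * l - 2))

variable [hl : Fact (4 ≤ l)]

/-- This makes l, like 1, a fixed point of j ↦ 2 - j. -/
lemma two_mul_natCast_self : 2 * (l : ZMod (2 * l - 2)) = 2 := by
  have h0 := hl.out
  have h1 : ((2 * l - 2 : ℕ) : ZMod (2 * l - 2)) = 0 := ZMod.natCast_self _
  rw [Nat.cast_sub (by omega)] at h1
  push_cast at h1
  linear_combination h1

omit hl in
lemma natCast_inj_of_lt {a b : ℕ} (ha : a < 2 * l - 2) (hb : b < 2 * l - 2) :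
    (a : ZMod (2 * l - 2)) = b ↔ a = b := by
  rw [ZMod.natCast_eq_natCast_iff', Nat.mod_eq_of_lt ha, Nat.mod_eq_of_lt hb]

lemma natCast_ne_one {a : ℕ} (h1 : 2 ≤ a) (h2 : a ≤ 2 * l - 2) : (a : ZMod (2 * l - 2)) ≠ 1 := by
  have h0 := hl.out
  rcases h2.lt_or_eq with h3 | rfl
  · have := natCast_inj_of_lt l h3 (b := 1) (by omega)
    rw [Nat.cast_one] at this
    rw [Ne, this]; omega
  · have := natCast_inj_of_lt l (a := 0) (b := 1) (by omega) (by omega)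
    rw [Nat.cast_one, Nat.cast_zero] at this
    rw [ZMod.natCast_self, Ne, this]; omega

lemma natCast_ne_natCast_self {a : ℕ} (h1 : a ≠ l) (h2 : a ≤ 2 * l - 2) :
    (a : ZMod (2 * l - 2)) ≠ l := by
  have h0 := hl.out
  rcases h2.lt_or_eq with h3 | rfl
  · rw [Ne, natCast_inj_of_lt l h3 (by omega)]; exact h1
  · have := natCast_inj_of_lt l (a := 0) (b := l) (by omega) (by omega)
    rw [Nat.cast_zero] at this
    rw [ZMod.natCast_self, Ne, this]; omega

omit hl in
lemma two_sub_eq_one_iff (j : ZMod (2 * l - 2)) : 2 - j = 1 ↔ j = 1 := by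
  constructor <;> intro h
  · linear_combination -h
  · linear_combination -h

lemma two_sub_eq_natCast_iff (j : ZMod (2 * l - 2)) : 2 - j = l ↔ j = l := by
  have h0 := two_mul_natCast_self l
  constructor <;> intro h
  · linear_combination -h - h0
  · linear_combination -h - h0

lemma one_ne_natCast_self : (1 : ZMod (2 * l - 2)) ≠ l :=
  fun h => natCast_ne_one l (a := l) (by have := hl.out; omega) (by have := hl.out; omega) h.symm

lemma reflect_reflect (a : LaxIdx l) : reflect l (reflect l a) = a := by
  have h0 := one_ne_natCast_self l
  rcases a with j | k
  · by_cases h1 : j = 1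
    · subst h1; simp [reflect]
    by_cases h2 : j = l
    · subst h2; simp [reflect, h1]
    · simp [reflect, h1, h2, two_sub_eq_one_iff, two_sub_eq_natCast_iff]
  · fin_cases k
    · simp [reflect]
    · simp [reflect, h0.symm]

lemma block_reflect (a : LaxIdx l) : block l (reflect l a) = 2 - block l a := by
  have h0 := two_mul_natCast_self l
  have h3 : 2 - (l : ZMod (2 * l - 2)) = l := by linear_combination -h0
  have h4 : 2 - (1 : ZMod (2 * l - 2)) = 1 := by ring
  rcases a with j | k
  · by_cases h1 : j = 1
    · subst h1; simp [reflect, block, h4]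
    by_cases h2 : j = l
    · subst h2; simp [reflect, h1, block, h3]
    · simp [reflect, h1, h2, block]
  · fin_cases k
    · simp [reflect, block, h4]
    · simp [reflect, block, h3]

omit hl in
lemma block_eq_iff {j : ZMod (2 * l - 2)} (h1 : j ≠ 1) (h2 : j ≠ l) (b : LaxIdx l) :
    block l b = j ↔ b = Sum.inl j := by
  rcases b with k | k
  · simp [block]
  · fin_cases k
    · simp [block, h1.symm]
    · simp [block, h2.symm]

lemma block_eq_one_iff (b : LaxIdx l) :
    block l b = 1 ↔ b = Sum.inl 1 ∨ b = Sum.inr 0 := by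
  have h0 := one_ne_natCast_self l
  rcases b with k | k
  · simp [block]
  · fin_cases k
    · simp [block]
    · simp [block, h0.symm]

lemma block_eq_natCast_iff (b : LaxIdx l) :
    block l b = l ↔ b = Sum.inl (l : ZMod (2 * l - 2)) ∨ b = Sum.inr 1 := by
  have h0 := one_ne_natCast_self l
  rcases b with k | k
  · simp [block]
  · fin_cases k
    · simp [block, h0]
    · simp [block]

/-- Away from 1 and l exactly one of j and 2 - j lies in [2, l - 1], so the case distinction in
`logV` is odd under the reflection. -/
lemma val_two_sub {j : ZMod (2 * l - 2)} (h1 : j ≠ 1) (h2 : j ≠ l) :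
    (2 ≤ j.val ∧ j.val ≤ l - 1 ∧ ¬(2 ≤ (2 - j).val ∧ (2 - j).val ≤ l - 1)) ∨
    (¬(2 ≤ j.val ∧ j.val ≤ l - 1) ∧ 2 ≤ (2 - j).val ∧ (2 - j).val ≤ l - 1) := by
  have h0 := hl.out
  have hlt := ZMod.val_lt j
  have hj : j = (j.val : ZMod (2 * l - 2)) := (ZMod.natCast_zmod_val j).symm
  have n1 : j.val ≠ 1 := fun h => h1 (by rw [hj, h, Nat.cast_one])
  have n2 : j.val ≠ l := fun h => h2 (by rw [hj, h])
  have e : 2 - j = ((2 * l - j.val : ℕ) : ZMod (2 * l - 2)) := by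
    rw [Nat.cast_sub (by omega), ← hj]
    push_cast
    rw [two_mul_natCast_self]
  have e2 : (2 - j).val = (2 * l - j.val) % (2 * l - 2) := by rw [e, ZMod.val_natCast]
  -- For j = 0 and j = 2 the representative 2l - j is at least the modulus and has to be reduced.
  rcases Nat.lt_or_ge j.val 3 with h3 | h3
  · have h4 : 2 * l - j.val = (2 - j.val) + (2 * l - 2) := by omega
    rw [h4, Nat.add_mod_right, Nat.mod_eq_of_lt (by omega)] at e2
    omega
  · rw [Nat.mod_eq_of_lt (by omega)] at e2
    omega

lemma logV_reflect (u : ℕ → ℂ → ℝ) (a : LaxIdx l) (w : ℂ) :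
    logV l u w (reflect l a) = -logV l u w a := by
  have h0 := one_ne_natCast_self l
  rcases a with j | k
  · by_cases h1 : j = 1
    · subst h1; simp [reflect, logV]
    by_cases h2 : j = l
    · subst h2; simp [reflect, h1, logV]
    · simp only [reflect, h1, h2, logV, two_sub_eq_one_iff, two_sub_eq_natCast_iff, if_false,
        sub_sub_cancel]
      rcases val_two_sub l h1 h2 with ⟨h3, h4, h5⟩ | ⟨h3, h4⟩
      · rw [if_neg h5, if_pos ⟨h3, h4⟩]
      · rw [if_pos h4, if_neg h3, neg_neg]
  · fin_cases k
    · simp [reflect, logV]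
    · simp [reflect, logV, h0.symm]

/-- Each diagonal entry of `log V` is one of the functions `±u_k`. -/
lemma exists_logV_eq (u : ℕ → ℂ → ℝ) (a : LaxIdx l) : ∃ k ∈ Finset.Icc 1 l,
    (∀ w, logV l u w a = u k w) ∨ (∀ w, logV l u w a = -u k w) := by
  have h0 := hl.out
  simp only [Finset.mem_Icc]
  rcases a with j | k
  · by_cases h1 : j = 1
    · exact ⟨1, by omega, Or.inr fun w => by simp [logV, h1]⟩
    by_cases h2 : j = l
    · exact ⟨l, by omega, Or.inl fun w => by simp [logV, h2, (one_ne_natCast_self l).symm]⟩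
    rcases val_two_sub l h1 h2 with ⟨h3, h4, h5⟩ | ⟨h3, h4, h5⟩
    · exact ⟨j.val, by omega, Or.inl fun w => by simp [logV, h1, h2, h3, h4]⟩
    · refine ⟨(2 - j).val, by omega, Or.inr fun w => ?_⟩
      simp only [logV, h1, h2, if_false, if_neg h3]
  · fin_cases k
    · exact ⟨1, by omega, Or.inl fun w => rfl⟩
    · exact ⟨l, by omega, Or.inr fun w => rfl⟩

lemma logV_natCast (u : ℕ → ℂ → ℝ) (w : ℂ) {c : ℕ} (h1 : 2 ≤ c) (h2 : c ≤ l - 1) :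
    logV l u w (Sum.inl (c : ZMod (2 * l - 2))) = u c w := by
  have h0 := hl.out
  have hv : (c : ZMod (2 * l - 2)).val = c := ZMod.val_cast_of_lt (by omega)
  rw [logV, if_neg (natCast_ne_one l h1 (by omega)),
    if_neg (natCast_ne_natCast_self l (by omega) (by omega)), hv, if_pos ⟨h1, h2⟩]

lemma reflect_natCast {c : ℕ} (h1 : 2 ≤ c) (h2 : c ≤ l - 1) :
    reflect l (Sum.inl (c : ZMod (2 * l - 2))) = Sum.inl (2 - (c : ZMod (2 * l - 2))) := by
  rw [reflect, if_neg (natCast_ne_one l h1 (by omega)),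
    if_neg (natCast_ne_natCast_self l (by omega) (by omega))]

lemma logV_two_sub_natCast (u : ℕ → ℂ → ℝ) (w : ℂ) {c : ℕ} (h1 : 2 ≤ c) (h2 : c ≤ l - 1) :
    logV l u w (Sum.inl (2 - (c : ZMod (2 * l - 2)))) = -u c w := by
  rw [← reflect_natCast l h1 h2, logV_reflect, logV_natCast l u w h1 h2]

/-- Summation over the blocks, from `1` to `N`. -/
lemma sum_zmod_eq_Icc (f : ZMod (2 * l - 2) → ℂ) :
    ∑ c, f c = ∑ c ∈ Finset.Icc 1 (2 * l - 2), f c := by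
  have h0 := hl.out
  symm
  refine Finset.sum_bij' (fun c _ => (c : ZMod (2 * l - 2)))
    (fun j _ => if j.val = 0 then 2 * l - 2 else j.val) (fun _ _ => Finset.mem_univ _) ?_ ?_ ?_
    (fun _ _ => rfl)
  · intro j _
    have := ZMod.val_lt j
    rw [Finset.mem_Icc]
    split_ifs <;> omega
  · intro c hc
    rw [Finset.mem_Icc] at hc
    rcases hc.2.lt_or_eq with h1 | rfl
    · rw [ZMod.val_cast_of_lt h1, if_neg (by omega)]
    · rw [ZMod.natCast_self, ZMod.val_zero, if_pos rfl]
  · intro j _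
    split_ifs with h1
    · rw [ZMod.natCast_self]
      exact ((ZMod.val_eq_zero j).mp h1).symm
    · exact ZMod.natCast_zmod_val j

lemma sum_zmod_eq_erase (f : ZMod (2 * l - 2) → ℂ) :
    ∑ c, f c = f 1 + f l + ∑ c ∈ (Finset.Icc 2 (2 * l - 2)).erase l, f c := by
  have h0 := hl.out
  rw [sum_zmod_eq_Icc, ← Finset.add_sum_Ioc_eq_sum_Icc (by omega), Nat.cast_one]
  have : Finset.Ioc 1 (2 * l - 2) = Finset.Icc 2 (2 * l - 2) := by ext; simp; omega
  rw [this, ← Finset.add_sum_erase (a := l) _ _ (by rw [Finset.mem_Icc]; omega)]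
  ring

/-- The map c ↦ 2l - c carries [l + 1, 2l - 2] onto [2, l - 1]; this gives the two sums in the
formula for γ_j. -/
lemma sum_zmod_eq_two_sub (f : ZMod (2 * l - 2) → ℂ) :
    ∑ c, f c = f 1 + f l + ∑ c ∈ Finset.Icc 2 (l - 1), f c
      + ∑ c ∈ Finset.Icc 2 (l - 1), f (2 - c) := by
  have h0 := hl.out
  have e : (Finset.Icc 2 (2 * l - 2)).erase l =
      Finset.Icc 2 (l - 1) ∪ Finset.Icc (l + 1) (2 * l - 2) := by
    ext; simp; omega
  have d : Disjoint (Finset.Icc 2 (l - 1)) (Finset.Icc (l + 1) (2 * l - 2)) := by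
    rw [Finset.disjoint_left]; intro a; simp; omega
  rw [sum_zmod_eq_erase, e, Finset.sum_union d, ← add_assoc]
  congr 1
  refine Finset.sum_nbij' (fun c => 2 * l - c) (fun c => 2 * l - c) ?_ ?_ ?_ ?_ ?_
  · intro c; simp; omega
  · intro c; simp; omega
  · intro c; simp; omega
  · intro c; simp; omega
  · intro c hc
    rw [Finset.mem_Icc] at hc
    congr 1
    rw [Nat.cast_sub (by omega)]
    push_cast
    rw [two_mul_natCast_self]; ring

lemma rem_eq (k : ℤ) : rem l k = (k : ZMod (2 * l - 2)).val := by
  have h0 := hl.out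
  have h1 := ZMod.val_intCast (n := 2 * l - 2) k
  have h2 : ((2 * l - 2 : ℕ) : ℤ) = 2 * (l : ℤ) - 2 := by omega
  rw [rem, ← h2, ← h1, Int.toNat_natCast]

end Index

/-! ### From bilinear equations to the Toda equation. -/

/-- The bilinear equations for `G_j = g_j` and for the factors `D, D'` of `g_2` and `E, E'` of `g_l`
turn a solution of the Toda equation into another one. -/
lemma IsTodaSolution.of_hirota {l : ℕ} (hl : 4 ≤ l) {U : Set ℂ} (hU : IsOpen U)
    {u u' : ℕ → ℂ → ℝ} (hu : IsTodaSolution l U u) {G : ℕ → ℂ → ℝ} {D D' E E' : ℂ → ℝ}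
    (cG : ∀ j, ContDiffOn ℝ 2 (G j) U) (cD : ContDiffOn ℝ 2 D U) (cD' : ContDiffOn ℝ 2 D' U)
    (cE : ContDiffOn ℝ 2 E U) (cE' : ContDiffOn ℝ 2 E' U)
    (pD : ∀ w ∈ U, 0 < D w / D' w) (pE : ∀ w ∈ U, 0 < E w / E' w)
    (pG : ∀ j ∈ Finset.Icc 2 (l - 1), ∀ w ∈ U, 0 < G (j + 1) w / G j w)
    (hG2 : ∀ w ∈ U, G 2 w = D w * D' w) (hGl : ∀ w ∈ U, G l w = E w * E' w)
    (h1 : ∀ w ∈ U, u' 1 w = u 1 w - Real.log (D w / D' w))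
    (hl' : ∀ w ∈ U, u' l w = u l w + Real.log (E w / E' w))
    (hj : ∀ j ∈ Finset.Icc 2 (l - 1), ∀ w ∈ U, u' j w = u j w + Real.log (G (j + 1) w / G j w))
    (LD : ∀ w ∈ U, Δ (fun w => Real.log (D w)) w
      = Real.exp (u 2 w) * Real.exp (u 1 w) * (1 - G 3 w / D w ^ 2))
    (LD' : ∀ w ∈ U, Δ (fun w => Real.log (D' w)) w
      = Real.exp (u 2 w) * Real.exp (-u 1 w) * (1 - G 3 w / D' w ^ 2))
    (LE : ∀ w ∈ U, Δ (fun w => Real.log (E w)) w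
      = Real.exp (-u (l - 1) w) * Real.exp (-u l w) * (1 - G (l - 1) w / E w ^ 2))
    (LE' : ∀ w ∈ U, Δ (fun w => Real.log (E' w)) w
      = Real.exp (-u (l - 1) w) * Real.exp (u l w) * (1 - G (l - 1) w / E' w ^ 2))
    (LG : ∀ j ∈ Finset.Icc 3 (l - 1), ∀ w ∈ U, Δ (fun w => Real.log (G j w)) w
      = Real.exp (u j w) * Real.exp (-u (j - 1) w) * (1 - G (j + 1) w * G (j - 1) w / G j w ^ 2)) :
    IsTodaSolution l U u' := by
  -- Division by zero gives 0, so a positive ratio forces both numerator and denominator to be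
  -- non-zero.
  have nD : ∀ w ∈ U, D w ≠ 0 := fun w hw h0 => by simpa [h0] using pD w hw
  have nD' : ∀ w ∈ U, D' w ≠ 0 := fun w hw h0 => by simpa [h0] using pD w hw
  have nE : ∀ w ∈ U, E w ≠ 0 := fun w hw h0 => by simpa [h0] using pE w hw
  have nE' : ∀ w ∈ U, E' w ≠ 0 := fun w hw h0 => by simpa [h0] using pE w hw
  have nG : ∀ j, 2 ≤ j → j ≤ l → ∀ w ∈ U, G j w ≠ 0 := by
    intro j h2 h3 w hw h0
    rcases h3.lt_or_eq with h4 | rfl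
    · simpa [h0] using pG j (Finset.mem_Icc.mpr ⟨h2, by omega⟩) w hw
    · rw [hGl w hw] at h0
      exact mul_ne_zero (nE w hw) (nE' w hw) h0
  have at' : ∀ {f : ℂ → ℝ}, ContDiffOn ℝ 2 f U → ∀ w ∈ U, ContDiffAt ℝ 2 f w :=
    fun hf w hw => hf.contDiffAt (hU.mem_nhds hw)
  have lg : ∀ {f : ℂ → ℝ}, ContDiffOn ℝ 2 f U → (∀ w ∈ U, f w ≠ 0) → ∀ w ∈ U,
      ContDiffAt ℝ 2 (fun w => Real.log (f w)) w :=
    fun hf h0 w hw => (at' hf w hw).log (h0 w hw)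
  have cu : ∀ j, 1 ≤ j → j ≤ l → ∀ w ∈ U, ContDiffAt ℝ 2 (u j) w :=
    fun j h2 h3 => at' (hu.contDiffOn j (Finset.mem_Icc.mpr ⟨h2, h3⟩))
  have e1 : ∀ w ∈ U, u' 1 =ᶠ[nhds w]
      (u 1 - fun w => Real.log (D w)) + fun w => Real.log (D' w) := by
    intro w hw
    filter_upwards [hU.mem_nhds hw] with x hx
    rw [h1 x hx, Real.log_div (nD x hx) (nD' x hx)]
    simp only [Pi.add_apply, Pi.sub_apply]; ring
  have el : ∀ w ∈ U, u' l =ᶠ[nhds w]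
      (u l + fun w => Real.log (E w)) - fun w => Real.log (E' w) := by
    intro w hw
    filter_upwards [hU.mem_nhds hw] with x hx
    rw [hl' x hx, Real.log_div (nE x hx) (nE' x hx)]
    simp only [Pi.add_apply, Pi.sub_apply]; ring
  have ej : ∀ j, 2 ≤ j → j ≤ l - 1 → ∀ w ∈ U, u' j =ᶠ[nhds w]
      (u j + fun w => Real.log (G (j + 1) w)) - fun w => Real.log (G j w) := by
    intro j h2 h3 w hw
    filter_upwards [hU.mem_nhds hw] with x hx
    rw [hj j (Finset.mem_Icc.mpr ⟨h2, h3⟩) x hx,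
      Real.log_div (nG (j + 1) (by omega) (by omega) x hx) (nG j h2 (by omega) x hx)]
    simp only [Pi.add_apply, Pi.sub_apply]; ring
  have L1 : ∀ w ∈ U, Δ (u' 1) w = Δ (u 1) w - Δ (fun w => Real.log (D w)) w
      + Δ (fun w => Real.log (D' w)) w := by
    intro w hw
    have a1 := cu 1 le_rfl (by omega) w hw
    have a2 := lg cD nD w hw
    have a3 : ContDiffAt ℝ 2 (u 1 - fun w => Real.log (D w)) w := a1.sub a2
    rw [InnerProductSpace.laplacian_congr_nhds (e1 w hw) |>.self_of_nhds,
      ContDiffAt.laplacian_add a3 (lg cD' nD' w hw), a1.laplacian_sub a2]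
  have Ll : ∀ w ∈ U, Δ (u' l) w = Δ (u l) w + Δ (fun w => Real.log (E w)) w
      - Δ (fun w => Real.log (E' w)) w := by
    intro w hw
    have a1 := cu l (by omega) le_rfl w hw
    have a2 := lg cE nE w hw
    have a3 : ContDiffAt ℝ 2 (u l + fun w => Real.log (E w)) w := a1.add a2
    rw [InnerProductSpace.laplacian_congr_nhds (el w hw) |>.self_of_nhds,
      ContDiffAt.laplacian_sub a3 (lg cE' nE' w hw), a1.laplacian_add a2]
  have Lj : ∀ j, 2 ≤ j → j ≤ l - 1 → ∀ w ∈ U, Δ (u' j) w = Δ (u j) w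
      + Δ (fun w => Real.log (G (j + 1) w)) w - Δ (fun w => Real.log (G j w)) w := by
    intro j h2 h3 w hw
    have a1 := cu j (by omega) (by omega) w hw
    have a2 := lg (cG (j + 1)) (nG (j + 1) (by omega) (by omega)) w hw
    have a3 : ContDiffAt ℝ 2 (u j + fun w => Real.log (G (j + 1) w)) w := a1.add a2
    rw [InnerProductSpace.laplacian_congr_nhds (ej j h2 h3 w hw) |>.self_of_nhds,
      ContDiffAt.laplacian_sub a3 (lg (cG j) (nG j h2 (by omega)) w hw),
      a1.laplacian_add a2]
  have LG2 : ∀ w ∈ U, Δ (fun w => Real.log (G 2 w)) w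
      = Δ (fun w => Real.log (D w)) w + Δ (fun w => Real.log (D' w)) w := by
    intro w hw
    have : (fun w => Real.log (G 2 w)) =ᶠ[nhds w]
        (fun w => Real.log (D w)) + fun w => Real.log (D' w) := by
      filter_upwards [hU.mem_nhds hw] with x hx
      rw [hG2 x hx, Real.log_mul (nD x hx) (nD' x hx)]; rfl
    rw [InnerProductSpace.laplacian_congr_nhds this |>.self_of_nhds,
      ContDiffAt.laplacian_add (lg cD nD w hw) (lg cD' nD' w hw)]
  have LGl : ∀ w ∈ U, Δ (fun w => Real.log (G l w)) w
      = Δ (fun w => Real.log (E w)) w + Δ (fun w => Real.log (E' w)) w := by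
    intro w hw
    have : (fun w => Real.log (G l w)) =ᶠ[nhds w]
        (fun w => Real.log (E w)) + fun w => Real.log (E' w) := by
      filter_upwards [hU.mem_nhds hw] with x hx
      rw [hGl x hx, Real.log_mul (nE x hx) (nE' x hx)]; rfl
    rw [InnerProductSpace.laplacian_congr_nhds this |>.self_of_nhds,
      ContDiffAt.laplacian_add (lg cE nE w hw) (lg cE' nE' w hw)]
  have X1 : ∀ w ∈ U, Real.exp (u' 1 w) = Real.exp (u 1 w) * (D' w / D w) := by
    intro w hw
    rw [h1 w hw, Real.exp_sub, Real.exp_log (pD w hw)]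
    field_simp
  have Xl : ∀ w ∈ U, Real.exp (u' l w) = Real.exp (u l w) * (E w / E' w) := by
    intro w hw
    rw [hl' w hw, Real.exp_add, Real.exp_log (pE w hw)]
  have Xj : ∀ j, 2 ≤ j → j ≤ l - 1 → ∀ w ∈ U,
      Real.exp (u' j w) = Real.exp (u j w) * (G (j + 1) w / G j w) := by
    intro j h2 h3 w hw
    have hm := Finset.mem_Icc.mpr ⟨h2, h3⟩
    rw [hj j hm w hw, Real.exp_add, Real.exp_log (pG j hm w hw)]
  constructor
  · intro j hjm
    obtain ⟨h2, h3⟩ := Finset.mem_Icc.mp hjm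
    intro w hw
    refine ContDiffAt.contDiffWithinAt ?_
    rcases eq_or_ne j 1 with rfl | hj1
    · exact (((cu 1 h2 h3 w hw).sub (lg cD nD w hw)).add (lg cD' nD' w hw)).congr_of_eventuallyEq
        (e1 w hw)
    rcases eq_or_ne j l with rfl | hjl
    · exact (((cu _ h2 h3 w hw).add (lg cE nE w hw)).sub (lg cE' nE' w hw)).congr_of_eventuallyEq
        (el w hw)
    · exact (((cu j h2 h3 w hw).add (lg (cG (j + 1)) (nG (j + 1) (by omega) (by omega)) w hw)).sub
        (lg (cG j) (nG j (by omega) (by omega)) w hw)).congr_of_eventuallyEq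
        (ej j (by omega) (by omega) w hw)
  -- The constants 1 in `LD` and `LD'` cancel the old right-hand side. The remaining terms e^{u_2 +
  -- u_1} G_3 / D² and e^{u_2 - u_1} G_3 / D'² are the new exponentials because G_2 = D D'.
  · intro w hw
    have n1 := nD w hw
    have n2 := nD' w hw
    have n3 := nG 2 le_rfl (by omega) w hw
    rw [L1 w hw, LD w hw, LD' w hw, hu.eq_one w hw, Real.exp_add (u' 2 w), Real.exp_sub (u' 2 w),
      X1 w hw, Xj 2 le_rfl (by omega) w hw, hG2 w hw]
    simp only [Real.exp_add, Real.exp_sub, Real.exp_neg]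
    field_simp
    ring
  · intro w hw
    have n1 := nD w hw
    have n2 := nD' w hw
    have n3 := nG 3 (by omega) (by omega) w hw
    rw [Lj 2 le_rfl (by omega) w hw, LG2 w hw, LD w hw, LD' w hw,
      LG 3 (Finset.mem_Icc.mpr ⟨le_rfl, by omega⟩) w hw, hu.eq_two w hw, Real.exp_add (u' 2 w),
      Real.exp_sub (u' 2 w), Real.exp_sub (u' 3 w), X1 w hw, Xj 2 le_rfl (by omega) w hw,
      Xj 3 (by omega) (by omega) w hw, hG2 w hw]
    simp only [Real.exp_add, Real.exp_sub, Real.exp_neg, Nat.reduceAdd, Nat.reduceSub]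
    field_simp
    ring
  · intro j hjm w hw
    obtain ⟨h2, h3⟩ := Finset.mem_Icc.mp hjm
    obtain ⟨k, rfl⟩ : ∃ k, j = k + 1 := ⟨j - 1, by omega⟩
    have n0 := nG k (by omega) (by omega) w hw
    have n1 := nG (k + 1) (by omega) (by omega) w hw
    have n2 := nG (k + 1 + 1) (by omega) (by omega) w hw
    rw [Lj (k + 1) (by omega) (by omega) w hw, LG (k + 1) (Finset.mem_Icc.mpr ⟨h2, by omega⟩) w hw,
      LG (k + 1 + 1) (Finset.mem_Icc.mpr ⟨by omega, by omega⟩) w hw, hu.eq_mid (k + 1) hjm w hw,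
      Real.exp_sub (u' (k + 1) w), Real.exp_sub (u' (k + 1 + 1) w)]
    simp only [add_tsub_cancel_right]
    rw [Xj k (by omega) (by omega) w hw, Xj (k + 1) (by omega) (by omega) w hw,
      Xj (k + 1 + 1) (by omega) (by omega) w hw]
    simp only [Real.exp_sub, Real.exp_neg]
    field_simp
    ring
  · intro w hw
    have ep := hu.eq_penultimate w hw
    obtain ⟨k, rfl⟩ : ∃ k, l = k + 2 := ⟨l - 2, by omega⟩
    simp only [add_tsub_cancel_right, Nat.add_one_sub_one] at *
    have n0 := nG k (by omega) (by omega) w hw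
    have n1 := nG (k + 1) (by omega) (by omega) w hw
    have n2 := nE w hw
    have n3 := nE' w hw
    have LGl' := LGl w hw
    have hGl' := hGl w hw
    rw [Lj (k + 1) (by omega) (by omega) w hw,
      LG (k + 1) (Finset.mem_Icc.mpr ⟨by omega, by omega⟩) w hw, LGl', LE w hw, LE' w hw, ep, Real.exp_sub (u' (k + 1) w),
      Real.exp_sub (u' (k + 2) w), Real.exp_sub (-u' (k + 2) w), Real.exp_neg (u' (k + 2) w)]
    simp only [add_tsub_cancel_right]
    rw [Xl w hw, Xj k (by omega) (by omega) w hw, Xj (k + 1) (by omega) (by omega) w hw, hGl']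
    simp only [Real.exp_sub, Real.exp_neg]
    field_simp
    ring
  · intro w hw
    have ep := hu.eq_last w hw
    obtain ⟨k, rfl⟩ : ∃ k, l = k + 2 := ⟨l - 2, by omega⟩
    simp only [Nat.reduceSubDiff] at *
    have n1 := nG (k + 1) (by omega) (by omega) w hw
    have n2 := nE w hw
    have n3 := nE' w hw
    have hGl' := hGl w hw
    rw [Ll w hw, LE w hw, LE' w hw, ep,
      Real.exp_sub (u' (k + 2) w), Real.exp_sub (-u' (k + 2) w), Real.exp_neg (u' (k + 2) w)]
    rw [Xl w hw, Xj (k + 1) (by omega) (by omega) w hw, hGl']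
    simp only [Real.exp_sub, Real.exp_neg]
    field_simp
    ring

/-! ### The matrix Lax pair and the explicit formulas as an instance of the chain. -/

section Instance

variable {l : ℕ} [hl : Fact (4 ≤ l)] {U : Set ℂ} {u : ℕ → ℂ → ℝ} {μ : ℂ} {H : ℂ → LaxIdx l → ℂ}

lemma HasWirtingerAt.ofReal_eq {f : ℂ → ℝ} {a b w : ℂ}
    (hf : HasWirtingerAt (fun w => (f w : ℂ)) a b w) : b = conj a := by
  have h1 := hf.star
  simp only [Complex.conj_ofReal] at h1
  rw [← hf.dzbar_eq, ← h1.dzbar_eq]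

/-- The diagonal entries of `V_z V⁻¹`. -/
noncomputable def logVz (l : ℕ) (u : ℕ → ℂ → ℝ) (a : LaxIdx l) (w : ℂ) : ℂ :=
  dz (fun w => (logV l u w a : ℂ)) w

lemma contDiffOn_logV (hu : IsTodaSolution l U u) (a : LaxIdx l) :
    ContDiffOn ℝ 2 (fun w => logV l u w a) U := by
  obtain ⟨k, hk, h1 | h1⟩ := exists_logV_eq l u a
  · exact (hu.contDiffOn k hk).congr fun w _ => h1 w
  · exact (hu.contDiffOn k hk).neg.congr fun w _ => h1 w

lemma hasWirtingerAt_logV (hU : IsOpen U) (hu : IsTodaSolution l U u) (a : LaxIdx l) {w : ℂ}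
    (hw : w ∈ U) :
    HasWirtingerAt (fun w => (logV l u w a : ℂ)) (logVz l u a w) (conj (logVz l u a w)) w := by
  have h1 : DifferentiableAt ℝ (fun w => logV l u w a) w :=
    ((contDiffOn_logV hu a).contDiffAt (hU.mem_nhds hw)).differentiableAt (by norm_num)
  have h2 := HasWirtingerAt.of_differentiableAt (Complex.ofRealCLM.differentiableAt.comp w h1)
  exact HasWirtingerAt.congr_deriv h2 rfl (HasWirtingerAt.ofReal_eq h2)

lemma hasWirtingerAt_expLogV (hU : IsOpen U) (hu : IsTodaSolution l U u) (a : LaxIdx l) {w : ℂ}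
    (hw : w ∈ U) :
    HasWirtingerAt (fun w => (Real.exp (logV l u w a) : ℂ))
      (logVz l u a w * Real.exp (logV l u w a)) (conj (logVz l u a w) * Real.exp (logV l u w a))
      w := by
  have h1 := HasWirtingerAt.comp_holomorphic (Complex.hasDerivAt_exp _)
    (hasWirtingerAt_logV hU hu a hw)
  simp only [Complex.ofReal_exp]
  exact h1.congr_deriv (mul_comm _ _) (mul_comm _ _)

lemma exp_logV_reflect (a : LaxIdx l) (w : ℂ) :
    Real.exp (logV l u w (reflect l a)) = (Real.exp (logV l u w a))⁻¹ := by
  rw [logV_reflect, Real.exp_neg]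

lemma V_inv (w : ℂ) : (V l u w)⁻¹
    = Matrix.diagonal fun a => (Real.exp (logV l u w (reflect l a)) : ℂ) := by
  refine Matrix.inv_eq_right_inv ?_
  rw [V, Matrix.diagonal_mul_diagonal, ← Matrix.diagonal_one]
  congr 1
  ext a
  rw [exp_logV_reflect, ← Complex.ofReal_mul, mul_inv_cancel₀ (Real.exp_ne_zero _),
    Complex.ofReal_one]

lemma P_eq (hU : IsOpen U) (hu : IsTodaSolution l U u) {w : ℂ} (hw : w ∈ U) :
    P l u w = Matrix.diagonal fun a => logVz l u a w := by
  have h1 : (Matrix.of fun a b => dz (fun w' => V l u w' a b) w)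
      = Matrix.diagonal fun a => logVz l u a w * Real.exp (logV l u w a) := by
    ext a b
    rw [Matrix.of_apply]
    by_cases hab : a = b
    · subst hab
      simp only [V, Matrix.diagonal_apply_eq]
      exact (hasWirtingerAt_expLogV hU hu a hw).dz_eq
    · simp only [V, Matrix.diagonal_apply_ne _ hab]
      exact (HasWirtingerAt.const 0 w).dz_eq
  rw [P, h1, V_inv, Matrix.diagonal_mul_diagonal]
  congr 1
  ext a
  rw [exp_logV_reflect, mul_assoc, ← Complex.ofReal_mul, mul_inv_cancel₀ (Real.exp_ne_zero _),
    Complex.ofReal_one, mul_one]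

/-- Since the non-zero blocks of J consist of ones, J and its transpose act by sums over the next
and the previous block. -/
lemma isLaxChain (hU : IsOpen U) (hu : IsTodaSolution l U u) (hH : IsLaxSolution l U u μ H) :
    IsLaxChain (block l) (reflect l) (fun a w => Real.exp (logV l u w a)) (logVz l u)
      (fun a w => H w a) μ U where
  invol := reflect_reflect l
  blk_invol := block_reflect l
  v_invol a w := by rw [exp_logV_reflect, mul_inv_cancel₀ (Real.exp_ne_zero _)]
  p_invol a w := by
    have : (fun w => (logV l u w (reflect l a) : ℂ)) = -fun w => (logV l u w a : ℂ) := by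
      ext w; simp [logV_reflect]
    rw [logVz, logVz, dz, dz, this, fderiv_neg]
    simp
    ring
  v_deriv w hw a := hasWirtingerAt_expLogV hU hu a hw
  h_deriv w hw a := by
    have h1 : DifferentiableAt ℝ (fun w => H w a) w :=
      differentiableAt_pi.mp (hH.differentiableOn.differentiableAt (hU.mem_nhds hw)) a
    refine (HasWirtingerAt.of_differentiableAt h1).congr_deriv ?_ ?_
    · have h2 := congrFun (hH.eq_z w hw) a
      rw [h2, P_eq hU hu hw, Matrix.add_mulVec, Matrix.smul_mulVec, Pi.add_apply, Pi.smul_apply,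
        Matrix.mulVec_diagonal, add_comm, smul_eq_mul]
      congr 2
      simp [Matrix.mulVec, dotProduct, J, blockSum, Finset.sum_filter]
    · have h2 := congrFun (hH.eq_zbar w hw) a
      rw [h2, Q, V_inv, Matrix.smul_mulVec, Pi.smul_apply, smul_eq_mul, one_div]
      congr 1
      simp only [Matrix.mulVec, dotProduct, V, J, blockSum, Finset.sum_filter,
        Matrix.mul_diagonal, Matrix.diagonal_mul, Matrix.transpose_apply, Matrix.of_apply,
        Finset.mul_sum]
      refine Finset.sum_congr rfl fun b _ => ?_
      have h3 : block l a = block l b + 1 ↔ block l b = block l a - 1 := by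
        constructor <;> intro h
        · linear_combination -h
        · linear_combination -h
      simp only [h3]
      split_ifs <;> ring

lemma norm_sq_eq (z : ℂ) : (‖z‖ : ℂ) ^ 2 = z * conj z := (Complex.mul_conj' z).symm

lemma ofReal_norm_sq_div (c : ℝ) (S : ℂ) :
    ((1 / c ^ 2 * ‖S‖ ^ 2 : ℝ) : ℂ) = 1 / (c : ℂ) * S * conj (1 / (c : ℂ) * S) := by
  push_cast
  rw [norm_sq_eq, map_mul, map_div₀, Complex.conj_ofReal, map_one]
  ring

lemma neg_mul_conj_eq : -(μ * conj μ) = ((-‖μ‖ ^ 2 : ℝ) : ℂ) := by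
  rw [Complex.ofReal_neg, Complex.ofReal_pow, norm_sq_eq]

/-- The sign disappears because the period is even; for |μ| ≠ 1 the factor in front of γ_j is
therefore finite. -/
lemma neg_mul_conj_pow : (-(μ * conj μ)) ^ (2 * l - 2) = ((‖μ‖ ^ (4 * l - 4) : ℝ) : ℂ) := by
  have h0 := hl.out
  have h1 : 2 * l - 2 = 2 * (l - 1) := by omega
  have h2 : 4 * l - 4 = 2 * (2 * (l - 1)) := by omega
  rw [neg_mul_conj_eq, ← Complex.ofReal_pow, h1, (even_two_mul _).neg_pow, ← pow_mul, h2]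

lemma neg_mul_conj_pow_ne_one (hμ' : ‖μ‖ ≠ 1) : (-(μ * conj μ)) ^ (2 * l - 2) ≠ 1 := by
  have h0 := hl.out
  rw [neg_mul_conj_pow]
  norm_cast
  rw [pow_eq_one_iff_of_nonneg (norm_nonneg μ) (by omega)]
  exact hμ'

lemma even_period (l : ℕ) : Even (2 * l - 2) := ⟨l - 1, by omega⟩

section Sums

variable (F : LaxIdx l → ℂ)

lemma blockSum_one : blockSum (block l) F 1 = F (Sum.inl 1) + F (Sum.inr 0) :=
  blockSum_eq_pair (by simp) (block_eq_one_iff l) F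

lemma blockSum_natCast_self :
    blockSum (block l) F l = F (Sum.inl (l : ZMod (2 * l - 2))) + F (Sum.inr 1) :=
  blockSum_eq_pair (by simp) (block_eq_natCast_iff l) F

lemma blockSum_natCast {c : ℕ} (h1 : 2 ≤ c) (h2 : c ≤ 2 * l - 2) (h3 : c ≠ l) :
    blockSum (block l) F c = F (Sum.inl (c : ZMod (2 * l - 2))) :=
  blockSum_eq_single (block_eq_iff l (natCast_ne_one l h1 h2) (natCast_ne_natCast_self l h3 h2)) F

lemma blockSum_two_sub_natCast {c : ℕ} (h1 : 2 ≤ c) (h2 : c ≤ 2 * l - 2) (h3 : c ≠ l) :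
    blockSum (block l) F (2 - c) = F (Sum.inl (2 - (c : ZMod (2 * l - 2)))) := by
  refine blockSum_eq_single (block_eq_iff l ?_ ?_) F
  · rw [Ne, two_sub_eq_one_iff]; exact natCast_ne_one l h1 h2
  · rw [Ne, two_sub_eq_natCast_iff]; exact natCast_ne_natCast_self l h3 h2

end Sums

lemma ofReal_gam (j : ℤ) (w : ℂ) : (gam l μ u H w j : ℂ)
    = IsLaxChain.gamma (block l) (reflect l) (fun a w => Real.exp (logV l u w a))
      (fun a w => H w a) μ (j : ZMod (2 * l - 2)) w := by
  have h0 := hl.out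
  have n0 := one_ne_natCast_self l
  rw [IsLaxChain.gamma, cyc, sum_zmod_eq_two_sub, gam]
  simp only [IsLaxChain.normSum]
  rw [blockSum_one, blockSum_natCast_self, neg_mul_conj_pow, neg_mul_conj_eq, Complex.ofReal_mul]
  congr 1
  · push_cast; rfl
  simp only [Complex.ofReal_add, Complex.ofReal_sum, rem_eq]
  congr 1
  congr 1
  congr 1
  · have e : (j : ZMod (2 * l - 2)) + 1 - 2 = ((j - 1 : ℤ) : ZMod (2 * l - 2)) := by
      push_cast; ring
    rw [e]
    simp only [Complex.ofReal_mul, Complex.ofReal_add, Complex.ofReal_pow, h, h12,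
      reflect, logV, if_true, Int.cast_one, norm_sq_eq]
  · have e : (j : ZMod (2 * l - 2)) + l - 2 = ((j + l - 2 : ℤ) : ZMod (2 * l - 2)) := by
      push_cast; ring
    rw [e]
    simp only [Complex.ofReal_mul, Complex.ofReal_add, Complex.ofReal_pow, h, hl2,
      reflect, logV, n0.symm, if_false, if_true, Int.cast_natCast, norm_sq_eq]
  · refine Finset.sum_congr rfl fun c hc => ?_
    obtain ⟨h1, h2⟩ := Finset.mem_Icc.mp hc
    have e : (j : ZMod (2 * l - 2)) + c - 2 = ((j + c - 2 : ℤ) : ZMod (2 * l - 2)) := by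
      push_cast; ring
    rw [e, blockSum_natCast _ h1 (by omega) (by omega), logV_reflect, logV_natCast l u w h1 h2]
    simp only [Complex.ofReal_mul, Complex.ofReal_pow, h, Int.cast_natCast, norm_sq_eq]
  · refine Finset.sum_congr rfl fun c hc => ?_
    obtain ⟨h1, h2⟩ := Finset.mem_Icc.mp hc
    have e : (j : ZMod (2 * l - 2)) + (2 - c) - 2 = ((j - c : ℤ) : ZMod (2 * l - 2)) := by
      push_cast; ring
    rw [e, blockSum_two_sub_natCast _ h1 (by omega) (by omega), logV_reflect,
      logV_two_sub_natCast l u w h1 h2, neg_neg]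
    simp only [Complex.ofReal_mul, Complex.ofReal_pow, h, Int.cast_natCast, Int.cast_sub,
      Int.cast_ofNat, norm_sq_eq]

/-- Both rows of the block give the same product, whence the factors 2 in the formula for g_j. -/
lemma pairSum_one (w : ℂ) : IsLaxChain.pairSum (block l) (reflect l) (fun a w => H w a) 1 w
    = 2 * (h l H w 1 * h12 l H w) := by
  rw [IsLaxChain.pairSum, blockSum_one]
  simp [reflect, h, h12]
  ring

lemma pairSum_natCast_self (w : ℂ) :
    IsLaxChain.pairSum (block l) (reflect l) (fun a w => H w a) l w
      = 2 * (h l H w l * hl2 l H w) := by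
  have n0 := one_ne_natCast_self l
  rw [IsLaxChain.pairSum, blockSum_natCast_self]
  simp [reflect, h, hl2, n0.symm]
  ring

lemma pairSum_natCast (w : ℂ) {c : ℕ} (h1 : 2 ≤ c) (h2 : c ≤ 2 * l - 2) (h3 : c ≠ l) :
    IsLaxChain.pairSum (block l) (reflect l) (fun a w => H w a) c w
      = h l H w c * h l H w (2 - c) := by
  rw [IsLaxChain.pairSum, blockSum_natCast _ h1 h2 h3, reflect, if_neg (natCast_ne_one l h1 h2),
    if_neg (natCast_ne_natCast_self l h3 h2)]
  simp [h]

lemma neg_one_pow_sub_one {c : ℕ} (hc : 1 ≤ c) : (-1 : ℂ) ^ (c - 1) = -(-1) ^ c := by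
  obtain ⟨k, rfl⟩ : ∃ k, c = k + 1 := ⟨c - 1, by omega⟩
  rw [pow_succ, add_tsub_cancel_right]; ring

/-- The blocks c and 2 - c contribute equally, so the alternating sum is -2 times `constraintForm`.
-/
lemma sum_sgn_pairSum (hc : IsLaxChain (block l) (reflect l) (fun a w => Real.exp (logV l u w a))
    (logVz l u) (fun a w => H w a) μ U) {w : ℂ} (hconstr : constraintForm l H w = 0) :
    ∑ c, sgn c * IsLaxChain.pairSum (block l) (reflect l) (fun a w => H w a) c w = 0 := by
  have h0 := hl.out
  have hN := even_period l
  have e : ∀ c ∈ Finset.Icc 2 (l - 1), sgn (2 - c : ZMod (2 * l - 2)) *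
      IsLaxChain.pairSum (block l) (reflect l) (fun a w => H w a) (2 - (c : ZMod (2 * l - 2))) w
      = -((-1) ^ (c - 1) * (h l H w c * h l H w (2 - c))) := by
    intro c hcm
    obtain ⟨h1, h2⟩ := Finset.mem_Icc.mp hcm
    rw [sgn_two_sub hN, hc.pairSum_two_sub, pairSum_natCast w h1 (by omega) (by omega),
      sgn_natCast hN, neg_one_pow_sub_one (by omega)]
    ring
  have e' : ∀ c ∈ Finset.Icc 2 (l - 1), sgn (c : ZMod (2 * l - 2)) *
      IsLaxChain.pairSum (block l) (reflect l) (fun a w => H w a) (c : ZMod (2 * l - 2)) w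
      = -((-1) ^ (c - 1) * (h l H w c * h l H w (2 - c))) := by
    intro c hcm
    rw [← e c hcm, sgn_two_sub hN, hc.pairSum_two_sub]
  rw [sum_zmod_eq_two_sub, Finset.sum_congr rfl e, Finset.sum_congr rfl e', sgn_one hN,
    sgn_natCast hN, pairSum_one, pairSum_natCast_self]
  rw [constraintForm, neg_one_pow_sub_one (by omega)] at hconstr
  rw [Finset.sum_neg_distrib]
  linear_combination (-2) * hconstr

lemma quadSum_eq (j : ℤ) (w : ℂ) :
    IsLaxChain.quadSum (block l) (reflect l) (fun a w => H w a) (j : ZMod (2 * l - 2)) w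
    = 1 / (2 * (l : ℂ) - 2) * (2 * (rem l (1 - j) : ℂ) * (h l H w 1 * h12 l H w)
        + 2 * (-1) ^ (l - 1) * (rem l (l - j) : ℂ) * (h l H w l * hl2 l H w)
        + ∑ c ∈ (Finset.Icc 2 (2 * l - 2)).erase l,
            (-1) ^ (c + 1) * (rem l (c - j) : ℂ) * (h l H w (2 - c) * h l H w c)) := by
  have h0 := hl.out
  have hN := even_period l
  rw [IsLaxChain.quadSum, quad, sum_zmod_eq_erase]
  congr 1
  · rw [Nat.cast_sub (by omega)]; push_cast; rfl
  simp only [rem_eq]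
  congr 1
  congr 1
  · rw [pairSum_one, sgn_add_one hN, sgn_one hN]
    push_cast; ring
  · rw [pairSum_natCast_self, sgn_add_one hN, sgn_natCast hN, neg_one_pow_sub_one (by omega)]
    push_cast; ring
  · refine Finset.sum_congr rfl fun c hc => ?_
    rw [Finset.mem_erase, Finset.mem_Icc] at hc
    rw [pairSum_natCast w hc.2.1 hc.2.2 hc.1, sgn_add_one hN, sgn_natCast hN]
    push_cast; ring

lemma ofReal_g (j : ℤ) (w : ℂ) : (g l μ u H w j : ℂ)
    = IsLaxChain.gfun (block l) (reflect l) (fun a w => Real.exp (logV l u w a))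
      (fun a w => H w a) μ (j : ZMod (2 * l - 2)) w := by
  have e1 : (j : ZMod (2 * l - 2)) - 1 = ((j - 1 : ℤ) : ZMod (2 * l - 2)) := by push_cast; rfl
  have e2 : 2 - (j : ZMod (2 * l - 2)) = ((2 - j : ℤ) : ZMod (2 * l - 2)) := by push_cast; rfl
  rw [IsLaxChain.gfun, quadSum_eq, e1, e2, ← ofReal_gam, ← ofReal_gam, g, Complex.ofReal_sub]
  congr 1
  · rw [ofReal_norm_sq_div]
    push_cast
    rfl
  · rw [mul_assoc, Complex.ofReal_mul, Complex.ofReal_pow, norm_sq_eq, Complex.ofReal_mul]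

end Instance

/-! ### Regularity of the Lax solution and of the g_j. -/

section Regularity

variable {U : Set ℂ} {n : WithTop ℕ∞} {f : ℂ → ℂ}

lemma ContDiffOn.conj (hf : ContDiffOn ℝ n f U) : ContDiffOn ℝ n (fun w => conj (f w)) U :=
  (Complex.conjCLE : ℂ →L[ℝ] ℂ).contDiff.comp_contDiffOn hf

lemma ContDiffOn.of_ofReal {f : ℂ → ℝ} (hf : ContDiffOn ℝ n (fun w => (f w : ℂ)) U) :
    ContDiffOn ℝ n f U :=
  Complex.reCLM.contDiff.comp_contDiffOn hf

lemma contDiffOn_ofReal {f : ℂ → ℝ} (hf : ContDiffOn ℝ n f U) :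
    ContDiffOn ℝ n (fun w => (f w : ℂ)) U :=
  Complex.ofRealCLM.contDiff.comp_contDiffOn hf

lemma contDiffOn_add_one_of_wirtinger (hU : IsOpen U) {n : ℕ} {a b : ℂ → ℂ}
    (hf : ∀ w ∈ U, HasWirtingerAt f (a w) (b w) w)
    (ha : ContDiffOn ℝ n a U) (hb : ContDiffOn ℝ n b U) :
    ContDiffOn ℝ (n + 1) f U := by
  rw [contDiffOn_succ_iff_fderiv_of_isOpen hU]
  refine ⟨fun w hw => (HasFDerivAt.differentiableAt (hf w hw)).differentiableWithinAt, by simp, ?_⟩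
  have h1 : ContDiffOn ℝ n (fun w => wirtinger (a w) (b w)) U :=
    ((ha.div_const 2).smul contDiffOn_const).add ((hb.div_const 2).smul contDiffOn_const)
  exact h1.congr fun w hw => HasFDerivAt.fderiv (hf w hw)

lemma contDiffOn_dz (hU : IsOpen U) {n : ℕ} (hf : ContDiffOn ℝ (n + 1) f U) :
    ContDiffOn ℝ n (dz f) U := by
  have h1 : ContDiffOn ℝ n (fderiv ℝ f) U := hf.fderiv_of_isOpen hU le_rfl
  exact (h1.clm_apply contDiffOn_const).sub
    (contDiffOn_const.mul (h1.clm_apply contDiffOn_const))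

namespace IsLaxChain

variable {N : ℕ} {ι : Type*} [Fintype ι] {blk : ι → ZMod N} {σ : ι → ι}
  {v : ι → ℂ → ℝ} {p : ι → ℂ → ℂ} {h : ι → ℂ → ℂ} {μ : ℂ}

lemma contDiffOn_col (hc : IsLaxChain blk σ v p h μ U) (hU : IsOpen U)
    (hv : ∀ a, ContDiffOn ℝ 2 (v a) U) (hp : ∀ a, ContDiffOn ℝ 1 (p a) U) (a : ι) :
    ContDiffOn ℝ 2 (h a) U := by
  -- The Lax pair expresses both derivatives of h through h, v and p, so each pass gains one
  -- derivative. The bound n ≤ 1 comes from p, which is only C¹; two passes from continuity reach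
  -- C².
  have step : ∀ n : ℕ, n ≤ 1 → (∀ a, ContDiffOn ℝ n (h a) U) →
      ∀ a, ContDiffOn ℝ (n + 1 : ℕ) (h a) U := by
    intro n hn hh a
    have n1 : (n : WithTop ℕ∞) ≤ 1 := by exact_mod_cast hn
    have n2 : (n : WithTop ℕ∞) ≤ 2 := n1.trans one_le_two
    have hv' : ∀ a, ContDiffOn ℝ n (fun w => (v a w : ℂ)) U :=
      fun a => contDiffOn_ofReal ((hv a).of_le n2)
    refine contDiffOn_add_one_of_wirtinger hU (fun w hw => hc.h_deriv w hw a) ?_ ?_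
    · exact (((hp a).of_le n1).mul (hh a)).add
        (contDiffOn_const.mul (ContDiffOn.sum fun b _ => hh b))
    · exact contDiffOn_const.mul ((hv' a).mul (ContDiffOn.sum fun b _ => (hh b).mul (hv' (σ b))))
  have h0 : ∀ a, ContDiffOn ℝ (0 : ℕ) (h a) U := by
    intro a
    rw [Nat.cast_zero, contDiffOn_zero]
    exact fun w hw => (hc.h_deriv w hw a).continuousAt.continuousWithinAt
  exact step 1 le_rfl (step 0 zero_le_one h0) a

variable (hv : ∀ a, ContDiffOn ℝ n (v a) U) (hh : ∀ a, ContDiffOn ℝ n (h a) U)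
include hv hh

omit [Fintype ι] in
lemma contDiffOn_normSq (a : ι) :
    ContDiffOn ℝ n (fun w => h a w * conj (h a w) * v (σ a) w) U :=
  ((hh a).mul (ContDiffOn.conj (hh a))).mul (contDiffOn_ofReal (hv (σ a)))

variable [NeZero N]

lemma contDiffOn_gamma (j : ZMod N) : ContDiffOn ℝ n (gamma blk σ v h μ j) U :=
  contDiffOn_const.mul (ContDiffOn.sum fun _ _ => contDiffOn_const.mul
    (ContDiffOn.sum fun a _ => contDiffOn_normSq hv hh a))

lemma contDiffOn_gfun (j : ZMod N) : ContDiffOn ℝ n (gfun blk σ v h μ j) U := by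
  have hq : ContDiffOn ℝ n (quadSum blk σ h j) U :=
    contDiffOn_const.mul (ContDiffOn.sum fun _ _ => contDiffOn_const.mul
      (ContDiffOn.sum fun a _ => (hh a).mul (hh (σ a))))
  exact (hq.mul (ContDiffOn.conj hq)).sub (contDiffOn_const.mul
    ((contDiffOn_gamma hv hh _).mul (contDiffOn_gamma hv hh _)))

end IsLaxChain

end Regularity

end EllipticToda

/-! ### Assembly of the Darboux transformation. -/

open EllipticToda in
/-- The Darboux transformation of the elliptic `D_l^{(1)}` Toda equation. -/
theorem mainTheorem10 (l : ℕ) [Fact (4 ≤ l)] (U : Set ℂ) (hU : IsOpen U)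
    (u : ℕ → ℂ → ℝ) (hu : EllipticToda.IsTodaSolution l U u)
    (μ : ℂ) (hμ : μ ≠ 0) (hμ' : ‖μ‖ ≠ 1)
    (H : ℂ → EllipticToda.LaxIdx l → ℂ) (hH : EllipticToda.IsLaxSolution l U u μ H)
    (hconstr : ∀ w ∈ U, EllipticToda.constraintForm l H w = 0)
    (hfirst : ∀ w ∈ U, 0 < EllipticToda.ratioFirst l μ u H w)
    (hlast : ∀ w ∈ U, 0 < EllipticToda.ratioLast l μ u H w)
    (hmid : ∀ j ∈ Finset.Icc 2 (l - 1), ∀ w ∈ U,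
      0 < EllipticToda.g l μ u H w (j + 1) / EllipticToda.g l μ u H w j) :
    EllipticToda.IsTodaSolution l U (EllipticToda.newU l μ u H) := by
  have hl : 4 ≤ l := Fact.out
  have hN := even_period l
  have hm := neg_mul_conj_pow_ne_one (l := l) hμ'
  have n0 := one_ne_natCast_self l
  have hc := isLaxChain hU hu hH
  have hq := fun w hw => sum_sgn_pairSum hc (hconstr w hw)
  have hv : ∀ a, ContDiffOn ℝ 2 (fun w => Real.exp (logV l u w a)) U :=
    fun a => (contDiffOn_logV hu a).exp
  have hp : ∀ a, ContDiffOn ℝ 1 (logVz l u a) U := fun a =>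
    contDiffOn_dz hU (n := 1) (contDiffOn_ofReal ((contDiffOn_logV hu a).of_le (by norm_num)))
  have hh := hc.contDiffOn_col hU hv hp
  have r1 : reflect l (Sum.inl 1) = Sum.inr 0 := by simp [reflect]
  have rl : reflect l (Sum.inl (l : ZMod (2 * l - 2))) = Sum.inr 1 := by simp [reflect, n0.symm]
  have r1' : reflect l (Sum.inr 0) = Sum.inl 1 := rfl
  have rl' : reflect l (Sum.inr 1) = Sum.inl (l : ZMod (2 * l - 2)) := rfl
  have b1 := block_eq_one_iff l
  have bl := block_eq_natCast_iff l
  have c1 : 2 - (1 : ZMod (2 * l - 2)) = 1 := by ring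
  have cl : 2 - (l : ZMod (2 * l - 2)) = l := by linear_combination -two_mul_natCast_self l
  -- The block after l is the mirror image of block l - 1, hence the exponent -u_{l-1} in the
  -- equations at the block l.
  have cl2 : (l : ZMod (2 * l - 2)) + 1 = 2 - ((l - 1 : ℕ) : ZMod (2 * l - 2)) := by
    rw [Nat.cast_sub (by omega)]
    push_cast
    linear_combination two_mul_natCast_self l
  have cl3 : (l : ZMod (2 * l - 2)) + 2 = 3 - ((l - 1 : ℕ) : ZMod (2 * l - 2)) := by
    rw [Nat.cast_sub (by omega)]
    push_cast
    linear_combination two_mul_natCast_self l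
  have cl4 : (l : ZMod (2 * l - 2)) + 1 = 3 - (l : ZMod (2 * l - 2)) := by
    linear_combination two_mul_natCast_self l
  have bj : ∀ j : ℕ, 2 ≤ j → j ≤ l - 1 → ∀ b, block l b = (j : ZMod (2 * l - 2)) ↔
      b = Sum.inl (j : ZMod (2 * l - 2)) := fun j h2 h3 =>
    block_eq_iff l (natCast_ne_one l h2 (by omega))
      (natCast_ne_natCast_self l (by omega) (by omega))
  have b2 : ∀ b, block l b = (1 : ZMod (2 * l - 2)) + 1 ↔ b = Sum.inl ((2 : ℕ) : ZMod _) := by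
    have := bj 2 le_rfl (by omega)
    have e : (1 : ZMod (2 * l - 2)) + 1 = ((2 : ℕ) : ZMod (2 * l - 2)) := by push_cast; ring
    rwa [e]
  have bl1 : ∀ b, block l b = (l : ZMod (2 * l - 2)) + 1 ↔
      b = Sum.inl (2 - ((l - 1 : ℕ) : ZMod (2 * l - 2))) := by
    rw [cl2]
    refine block_eq_iff l ?_ ?_
    · rw [Ne, two_sub_eq_one_iff]
      exact natCast_ne_one l (by omega) (by omega)
    · rw [Ne, two_sub_eq_natCast_iff]
      exact natCast_ne_natCast_self l (by omega) (by omega)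
  have lv1 : ∀ w, logV l u w (Sum.inl 1) = -u 1 w := fun w => by simp [logV]
  have lvl : ∀ w, logV l u w (Sum.inl (l : ZMod (2 * l - 2))) = u l w :=
    fun w => by simp [logV, n0.symm]
  have lv1' : ∀ w, logV l u w (Sum.inr 0) = u 1 w := fun w => rfl
  have lvl' : ∀ w, logV l u w (Sum.inr 1) = -u l w := fun w => rfl
  have gD : ∀ w, ((‖h l H w 1‖ ^ 2 * Real.exp (u 1 w) - gam l μ u H w 1 : ℝ) : ℂ)
      = H w (Sum.inl 1) * starRingEnd ℂ (H w (Sum.inl 1))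
        * Real.exp (logV l u w (reflect l (Sum.inl 1)))
        - IsLaxChain.gamma (block l) (reflect l) (fun a w => Real.exp (logV l u w a))
      (fun a w => H w a) μ 1 w := by
    intro w
    rw [Complex.ofReal_sub, ofReal_gam, r1, lv1', Int.cast_one, Complex.ofReal_mul,
      Complex.ofReal_pow, norm_sq_eq, h, Int.cast_one]
  have gD' : ∀ w, ((‖h12 l H w‖ ^ 2 * Real.exp (-u 1 w) - gam l μ u H w 1 : ℝ) : ℂ)
      = H w (Sum.inr 0) * starRingEnd ℂ (H w (Sum.inr 0))
        * Real.exp (logV l u w (reflect l (Sum.inr 0)))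
        - IsLaxChain.gamma (block l) (reflect l) (fun a w => Real.exp (logV l u w a))
      (fun a w => H w a) μ 1 w := by
    intro w
    rw [Complex.ofReal_sub, ofReal_gam, r1', lv1, Int.cast_one, Complex.ofReal_mul,
      Complex.ofReal_pow, norm_sq_eq, h12]
  have gE : ∀ w, ((‖h l H w l‖ ^ 2 * Real.exp (-u l w) - gam l μ u H w l : ℝ) : ℂ)
      = H w (Sum.inl l) * starRingEnd ℂ (H w (Sum.inl l))
        * Real.exp (logV l u w (reflect l (Sum.inl l)))
        - IsLaxChain.gamma (block l) (reflect l) (fun a w => Real.exp (logV l u w a))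
      (fun a w => H w a) μ l w := by
    intro w
    rw [Complex.ofReal_sub, ofReal_gam, rl, lvl', Int.cast_natCast, Complex.ofReal_mul,
      Complex.ofReal_pow, norm_sq_eq, h, Int.cast_natCast]
  have gE' : ∀ w, ((‖hl2 l H w‖ ^ 2 * Real.exp (u l w) - gam l μ u H w l : ℝ) : ℂ)
      = H w (Sum.inr 1) * starRingEnd ℂ (H w (Sum.inr 1))
        * Real.exp (logV l u w (reflect l (Sum.inr 1)))
        - IsLaxChain.gamma (block l) (reflect l) (fun a w => Real.exp (logV l u w a))
      (fun a w => H w a) μ l w := by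
    intro w
    rw [Complex.ofReal_sub, ofReal_gam, rl', lvl, Int.cast_natCast, Complex.ofReal_mul,
      Complex.ofReal_pow, norm_sq_eq, hl2]
  have gG : ∀ (j : ℕ) w, (g l μ u H w j : ℂ) = IsLaxChain.gfun (block l) (reflect l)
      (fun a w => Real.exp (logV l u w a)) (fun a w => H w a) μ (j : ZMod (2 * l - 2)) w := by
    intro j w
    rw [ofReal_g, Int.cast_natCast]
  have cpair : ∀ (a : LaxIdx l) (c : ZMod (2 * l - 2)), ContDiffOn ℝ 2 (fun w =>
      H w a * starRingEnd ℂ (H w a) * (Real.exp (logV l u w (reflect l a)) : ℂ)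
        - IsLaxChain.gamma (block l) (reflect l) (fun a w => Real.exp (logV l u w a))
      (fun a w => H w a) μ c w) U := fun a c =>
    (IsLaxChain.contDiffOn_normSq hv hh a).sub (IsLaxChain.contDiffOn_gamma hv hh c)
  have nz : ∀ {x y : ℝ}, 0 < x / y → x ≠ 0 ∧ y ≠ 0 := fun {x y} hxy =>
    ⟨fun h0 => by simp [h0] at hxy, fun h0 => by simp [h0] at hxy⟩
  have pair1 : ∀ b, block l b = 1 ↔ b = Sum.inl 1 ∨ b = reflect l (Sum.inl 1) := by rwa [r1]
  have pair1' : ∀ b, block l b = 1 ↔ b = Sum.inr 0 ∨ b = reflect l (Sum.inr 0) := fun b => by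
    rw [r1', b1 b, or_comm]
  have pairl : ∀ b, block l b = l ↔ b = Sum.inl (l : ZMod (2 * l - 2))
      ∨ b = reflect l (Sum.inl (l : ZMod (2 * l - 2))) := by rwa [rl]
  have pairl' : ∀ b, block l b = l ↔ b = Sum.inr 1 ∨ b = reflect l (Sum.inr 1) := fun b => by
    rw [rl', bl b, or_comm]
  have e3 : (1 : ZMod (2 * l - 2)) + 2 = ((3 : ℕ) : ZMod (2 * l - 2)) := by push_cast; ring
  have g3 : ∀ w, (g l μ u H w (3 : ℕ) : ℂ) = IsLaxChain.gfun (block l) (reflect l)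
      (fun a w => Real.exp (logV l u w a)) (fun a w => H w a) μ (1 + 2) w := fun w => by
    rw [gG, e3]
  -- By reflection g_{l+2} = g_{l-1}: the chain folds back at the block l.
  have gl2 : ∀ w ∈ U, (g l μ u H w (l - 1 : ℕ) : ℂ) = IsLaxChain.gfun (block l) (reflect l)
      (fun a w => Real.exp (logV l u w a)) (fun a w => H w a) μ (l + 2) w := fun w hw => by
    rw [gG, cl3, hc.gfun_three_sub hN (hq w hw)]
  refine IsTodaSolution.of_hirota hl hU hu (G := fun j w => g l μ u H w j)
    (D := fun w => ‖h l H w 1‖ ^ 2 * Real.exp (u 1 w) - gam l μ u H w 1)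
    (D' := fun w => ‖h12 l H w‖ ^ 2 * Real.exp (-u 1 w) - gam l μ u H w 1)
    (E := fun w => ‖h l H w l‖ ^ 2 * Real.exp (-u l w) - gam l μ u H w l)
    (E' := fun w => ‖hl2 l H w‖ ^ 2 * Real.exp (u l w) - gam l μ u H w l)
    ?_ ?_ ?_ ?_ ?_ hfirst hlast ?_ ?_ ?_ ?_ ?_ ?_ ?_ ?_ ?_ ?_ ?_
  · intro j
    refine ContDiffOn.of_ofReal ?_
    simp only [gG]
    exact IsLaxChain.contDiffOn_gfun hv hh _
  · refine ContDiffOn.of_ofReal ?_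
    simp only [gD]
    exact cpair _ _
  · refine ContDiffOn.of_ofReal ?_
    simp only [gD']
    exact cpair _ _
  · refine ContDiffOn.of_ofReal ?_
    simp only [gE]
    exact cpair _ _
  · refine ContDiffOn.of_ofReal ?_
    simp only [gE']
    exact cpair _ _
  · intro j hj w hw
    have := hmid j hj w hw
    exact_mod_cast this
  · intro w hw
    have h1 := (hc.gfun_pair hN hm (hq w hw) c1 (by simp [r1]) pair1).2.2
    have e : (1 : ZMod (2 * l - 2)) + 1 = ((2 : ℕ) : ZMod (2 * l - 2)) := by push_cast; ring
    have h2 := gD' w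
    rw [r1'] at h2
    rw [← gD, r1, ← h2, e, ← gG] at h1
    exact_mod_cast h1
  · intro w hw
    have h1 := (hc.gfun_pair hN hm (hq w hw) cl (by simp [rl]) pairl).2.2
    have h2 := gE' w
    rw [rl'] at h2
    -- The factorization is that of g_{l+1}, which equals g_l by reflection.
    rw [← gE, rl, ← h2, cl4, hc.gfun_three_sub hN (hq w hw), ← gG] at h1
    exact_mod_cast h1
  · intro w _
    simp [newU, ratioFirst]
  · intro w _
    simp [newU, ratioLast, show l ≠ 1 by omega]
  · intro j hj w _
    rw [Finset.mem_Icc] at hj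
    simp [newU, show j ≠ 1 by omega, show j ≠ l by omega]
  · intro w hw
    have h1 := hc.laplacian_log_pair hU hw hμ hN hm (hq w hw) c1 (by simp [r1]) pair1 b2
      (fun w _ => gD w) (nz (hfirst w hw)).1 (g3 w)
    rwa [r1, lv1', logV_natCast l u w le_rfl (by omega)] at h1
  · intro w hw
    have h1 := hc.laplacian_log_pair hU hw hμ hN hm (hq w hw) c1 (by simp [r1']) pair1' b2
      (fun w _ => gD' w) (nz (hfirst w hw)).2 (g3 w)
    rwa [r1', lv1, logV_natCast l u w le_rfl (by omega)] at h1
  · intro w hw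
    have h1 := hc.laplacian_log_pair hU hw hμ hN hm (hq w hw) cl (by simp [rl]) pairl bl1
      (fun w _ => gE w) (nz (hlast w hw)).1 (gl2 w hw)
    rwa [rl, lvl', logV_two_sub_natCast l u w (by omega) le_rfl] at h1
  · intro w hw
    have h1 := hc.laplacian_log_pair hU hw hμ hN hm (hq w hw) cl (by simp [rl']) pairl' bl1
      (fun w _ => gE' w) (nz (hlast w hw)).2 (gl2 w hw)
    rwa [rl', lvl, logV_two_sub_natCast l u w (by omega) le_rfl] at h1
  · intro j hj w hw
    obtain ⟨h2, h3⟩ := Finset.mem_Icc.mp hj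
    have ep : ((j + 1 : ℕ) : ZMod (2 * l - 2)) = (j : ZMod (2 * l - 2)) + 1 := by push_cast; rfl
    have em : ((j - 1 : ℕ) : ZMod (2 * l - 2)) = (j : ZMod (2 * l - 2)) - 1 := by
      rw [Nat.cast_sub (by omega), Nat.cast_one]
    have hb := bj (j - 1) (by omega) (by omega)
    -- For 3 ≤ j ≤ l - 1 both j and j - 1 avoid the blocks of size two.
    have h1 := hc.laplacian_log_gfun hU hw hμ hN hm (hq w hw) (bj j (by omega) h3)
      (b := Sum.inl ((j - 1 : ℕ) : ZMod (2 * l - 2))) (by rwa [em] at hb ⊢)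
      (fun w _ => gG j w) (nz (hmid j (Finset.mem_Icc.mpr ⟨by omega, h3⟩) w hw)).2
      (by rw [gG (j + 1), ep]) (by rw [gG (j - 1), em])
    rwa [logV_reflect, logV_natCast l u w (by omega) h3,
      logV_natCast l u w (by omega) (by omega)] at h1
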